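/- Let $\{0,1\}^{\omega}$ be the Cantor space of left-infinite words $\ldots x_2x_1x_0$ over $\{0,1\}$, and write $g=\sigma(g_0,g_1)$ if $(vx)\cdot g=(v\cdot g_x)\,\sigma(x)$ for all words $v$ and letters $x$ (no $\sigma$ is written if it is trivial). Let $a=\sigma$ (with $\sigma=(0\,1)$), $b=(1,a)$, $c=(c,b)$ be the generators of $\mathfrak K(11,0)$. For $j\in\{0,1,2\}$ let $P_j=\bigcup_{k\ge 0}\{0,1\}^{\omega}1\,0^{3k+j}$. Let $c_0,c_1,c_2$ be the homeomorphisms that act as $c$ on $P_0\cup P_1$, $P_0\cup P_2$, $P_1\cup P_2$, respectively, and as the identity elsewhere. Put $S=\{a,b,c_0,c_1,c_2\}$, $G=\langle S\rangle$ and $\xi=0^{\omega}$. Definitions. For a point $\zeta$ let $G_\zeta$ be its stabilizer, $G_{(\zeta)}$ the subgroup of elements fixing a neighborhood of $\zeta$ pointwise, and $G_\zeta/G_{(\zeta)}$ its group of germs; $\zeta$ is singular if this group is non-trivial. A singular point $\zeta$ is germ-defining if (i) $\zeta$ is the only point $\zeta'$ of its $G$-orbit such that some $s\in S$ fixes $\zeta'$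 but does not fix a neighborhood of $\zeta'$ pointwise; and (ii) whenever $\zeta'\in G\zeta$, $m\ge2$, $s_1,\dots,s_m\in S\cup S^{-1}$ are such that the points $\zeta', s_1(\zeta'),\dots,s_{m-1}\cdots s_1(\zeta')$ are pairwise distinct and $s_m\cdots s_1(\zeta')=\zeta'$, the element $s_m\cdots s_1$ fixes a neighborhood of $\zeta'$ pointwise. It is a purely non-Hausdorff singularity if it is germ-defining and for every $g\in G_\zeta$ the interior of the fixed point set of $g$ accumulates on $\zeta$. A fragmentation of a homeomorphism $h$ of finite order, with respect to a finite partition of $\{x: h(x)\ne x\}$ into $h$-invariant open pieces, is a finite group $F$ of homeomorphisms such that every $g\in F$ is trivial on the fixed points of $h$ and coincides on each piece with some power of $h$, and such that on each piece $P$ every restriction $h^k|_P$ is realized by some element of $F$. A fragmentation of a group with a given finite generating set is a group generated by fragmentations of its generators. With $|g|$ the word length with respect to $S$, let $\gamma_G(R)=\#\{g\in G: |g|\le R\}$, and write $f_1\preccurlyeq f_2$ if there is $C\ge1$ with $f_1(R)\le f_2(CR)$ for all $R\ge1$. Then: 1. $c_0=(c_1,b)$, $c_1=(c_2,b)$, $c_2=(c_0,1)$.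 2. $\langle c_0,c_1,c_2\rangle$ is a fragmentation of $c$ with respect to the pieces $P_j\cap\{x: c(x)\neq x\}$, $j=0,1,2$, and $G$ is a fragmentation of $\mathfrak K(11,0)=\langle a,b,c\rangle$. 3. $\xi$ is the unique purely non-Hausdorff singularity of $G$. 4. $\langle c_0,c_1,c_2\rangle\cong(\mathbb Z/2\mathbb Z)^2$ fixes $\xi$, every element of $G_\xi$ has the same germ at $\xi$ as exactly one element of $\langle c_0,c_1,c_2\rangle$, and $G_\xi/G_{(\xi)}\cong(\mathbb Z/2\mathbb Z)^2$. 5. The polynomial $x^5+x^4+x^3-2$ has exactly one positive root $\eta$, $|\eta-0.9028|<0.00005$, $\left|\frac{\log 2}{\log 2-\log\eta}-0.8715\right|<0.00005$, and $$\gamma_G(R)\preccurlyeq\exp(R^{\alpha})\quad\text{for every }\alpha>\frac{\log 2}{\log 2-\log\eta}.$$ -/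

import Mathlib

open Topology Filter

namespace FragK110

section Growth

/-- Word length with respect to the letters in `S ∪ S⁻¹` (meaningful on the subgroup generated
by `S`). -/
noncomputable def wordLength {Γ : Type*} [Group Γ] (S : Set Γ) (g : Γ) : ℕ :=
  sInf {n : ℕ | ∃ l : List Γ, (∀ s ∈ l, s ∈ S ∨ s⁻¹ ∈ S) ∧ l.prod = g ∧ l.length = n}

/-- The ball of radius `R` in the group generated by `S`. -/
def wordBall {Γ : Type*} [Group Γ] (S : Set Γ) (R : ℝ) : Set Γ :=
  {g : Γ | g ∈ Subgroup.closure S ∧ (wordLength S g : ℝ) ≤ R}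

/-- The growth function `γ(R)` of the group generated by `S`. -/
noncomputable def growth {Γ : Type*} [Group Γ] (S : Set Γ) (R : ℝ) : ℕ := (wordBall S R).ncard

theorem exists_word {Γ : Type*} [Group Γ] (S : Set Γ) {g : Γ} (hg : g ∈ Subgroup.closure S) :
    ∃ l : List Γ, (∀ s ∈ l, s ∈ S ∨ s⁻¹ ∈ S) ∧ l.prod = g ∧ l.length = wordLength S g := by
  have hne : {n : ℕ | ∃ l : List Γ, (∀ s ∈ l, s ∈ S ∨ s⁻¹ ∈ S) ∧ l.prod = g ∧
      l.length = n}.Nonempty := by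
    rw [← Subgroup.mem_toSubmonoid, Subgroup.closure_toSubmonoid] at hg
    obtain ⟨l, hl, hp⟩ := Submonoid.exists_list_of_mem_closure hg
    exact ⟨l.length, l, fun s hs => by simpa using hl s hs, hp, rfl⟩
  exact Nat.sInf_mem hne

/-- For finite `S` the balls are finite, so that `growth` really counts their elements. -/
theorem wordBall_finite {Γ : Type*} [Group Γ] (S : Set Γ) (hS : S.Finite) (R : ℝ) :
    (wordBall S R).Finite := by
  have hT : (S ∪ S⁻¹).Finite := hS.union hS.inv
  have : Finite ↥(S ∪ S⁻¹) := hT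
  refine ((List.finite_length_le ↥(S ∪ S⁻¹) ⌊R⌋₊).image
    (fun l => (l.map Subtype.val).prod)).subset ?_
  rintro g ⟨hg, hR⟩
  obtain ⟨l, hl, hp, hlen⟩ := exists_word S hg
  refine ⟨l.attach.map (fun s => ⟨s.1, by simpa using hl s.1 s.2⟩), ?_, ?_⟩
  · simp only [Set.mem_ofPred_eq, List.length_map, List.length_attach, hlen]
    exact Nat.le_floor hR
  · simp [List.map_map, Function.comp_def, hp]

/-- `f₁ ≼ f₂`: there is `C ≥ 1` with `f₁ R ≤ f₂ (C R)` for all `R ≥ 1`. -/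
def Dominated (f₁ f₂ : ℝ → ℝ) : Prop :=
  ∃ C : ℝ, 1 ≤ C ∧ ∀ R : ℝ, 1 ≤ R → f₁ R ≤ f₂ (C * R)

end Growth

section Germs

/-- The stabilizer `G_ζ` of a point. -/
def pointStab {X : Type*} [TopologicalSpace X] (G : Subgroup (X ≃ₜ X)) (ζ : X) :
    Subgroup (X ≃ₜ X) where
  carrier := {g | g ∈ G ∧ g ζ = ζ}
  one_mem' := ⟨G.one_mem, rfl⟩
  mul_mem' := by
    rintro g h ⟨hg, hg'⟩ ⟨hh, hh'⟩
    exact ⟨G.mul_mem hg hh, by rw [Homeomorph.mul_apply, hh', hg']⟩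
  inv_mem' := by
    rintro g ⟨hg, hg'⟩
    refine ⟨G.inv_mem hg, ?_⟩
    rw [Homeomorph.inv_apply, Homeomorph.symm_apply_eq, hg']

/-- The neighborhood stabilizer `G_(ζ)`: the elements of `G` that fix a neighborhood of `ζ`
pointwise. -/
def nbhdStab {X : Type*} [TopologicalSpace X] (G : Subgroup (X ≃ₜ X)) (ζ : X) :
    Subgroup (X ≃ₜ X) where
  carrier := {g | g ∈ G ∧ ∀ᶠ x in 𝓝 ζ, g x = x}
  one_mem' := ⟨G.one_mem, Eventually.of_forall fun _ => rfl⟩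
  mul_mem' := by
    rintro g h ⟨hg, hg'⟩ ⟨hh, hh'⟩
    refine ⟨G.mul_mem hg hh, ?_⟩
    filter_upwards [hg', hh'] with x hx hx'
    rw [Homeomorph.mul_apply, hx', hx]
  inv_mem' := by
    rintro g ⟨hg, hg'⟩
    refine ⟨G.inv_mem hg, ?_⟩
    filter_upwards [hg'] with x hx
    rw [Homeomorph.inv_apply, Homeomorph.symm_apply_eq, hx]

instance {X : Type*} [TopologicalSpace X] (G : Subgroup (X ≃ₜ X)) (ζ : X) :
    ((nbhdStab G ζ).subgroupOf (pointStab G ζ)).Normal where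
  conj_mem := by
    rintro ⟨n, hn⟩ hn' ⟨g, hg⟩
    rw [Subgroup.mem_subgroupOf] at hn' ⊢
    refine ⟨G.mul_mem (G.mul_mem hg.1 hn'.1) (G.inv_mem hg.1), ?_⟩
    have hgζ : (g⁻¹ : X ≃ₜ X) ζ = ζ := ((pointStab G ζ).inv_mem hg).2
    have ht : Tendsto (g⁻¹ : X ≃ₜ X) (𝓝 ζ) (𝓝 ζ) := by
      have := (g⁻¹ : X ≃ₜ X).continuous.tendsto ζ
      rwa [hgζ] at this
    filter_upwards [ht.eventually hn'.2] with x hx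
    change g (n ((g⁻¹ : X ≃ₜ X) x)) = x
    change n ((g⁻¹ : X ≃ₜ X) x) = (g⁻¹ : X ≃ₜ X) x at hx
    rw [hx]
    exact g.apply_symm_apply x

/-- The group of germs `G_ζ / G_(ζ)`. -/
abbrev GermGroup {X : Type*} [TopologicalSpace X] (G : Subgroup (X ≃ₜ X)) (ζ : X) : Type _ :=
  ↥(pointStab G ζ) ⧸ (nbhdStab G ζ).subgroupOf (pointStab G ζ)

/-- `ζ` is singular for `G`: its group of germs is non-trivial. -/
def IsSingular {X : Type*} [TopologicalSpace X] (G : Subgroup (X ≃ₜ X)) (ζ : X) : Prop :=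
  Nontrivial (GermGroup G ζ)

/-- `ζ` is a singular point of the generating set `S`: some generator fixes `ζ` but no
neighborhood of `ζ` pointwise. -/
def IsSingularOfGenerators {X : Type*} [TopologicalSpace X] (S : Set (X ≃ₜ X)) (ζ : X) : Prop :=
  ∃ s ∈ S, s ζ = ζ ∧ ¬ ∀ᶠ x in 𝓝 ζ, s x = x

/-- The list `l = [s_m, …, s_1]` of letters from `S ∪ S⁻¹` labels a nonloop cycle at `ζ`:
`m ≥ 2`, the points `ζ, s_1 ζ, …, s_{m-1} ⋯ s_1 ζ` are pairwise distinct and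
`s_m ⋯ s_1 ζ = ζ`. -/
def IsNonloopCycle {X : Type*} [TopologicalSpace X] (S : Set (X ≃ₜ X)) (ζ : X)
    (l : List (X ≃ₜ X)) : Prop :=
  2 ≤ l.length ∧ (∀ s ∈ l, s ∈ S ∨ s⁻¹ ∈ S) ∧
    Set.InjOn (fun i : ℕ => (l.drop i).prod ζ) (Set.Icc 1 l.length) ∧ l.prod ζ = ζ

/-- `ξ` is a germ-defining singular point of the group generated by `S`. -/
def IsGermDefining {X : Type*} [TopologicalSpace X] (S : Set (X ≃ₜ X)) (ξ : X) : Prop :=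
  IsSingular (Subgroup.closure S) ξ ∧
  (∀ g ∈ Subgroup.closure S, IsSingularOfGenerators S (g ξ) ↔ g ξ = ξ) ∧
  (∀ g ∈ Subgroup.closure S, ∀ l : List (X ≃ₜ X), IsNonloopCycle S (g ξ) l →
    ∀ᶠ x in 𝓝 (g ξ), l.prod x = x)

/-- `ξ` is a purely non-Hausdorff singularity of the group generated by `S`: it is germ-defining,
and for every `g` in the stabilizer of `ξ` the interior of the fixed point set of `g`
accumulates on `ξ`. -/
def IsPurelyNonHausdorff {X : Type*} [TopologicalSpace X] (S : Set (X ≃ₜ X)) (ξ : X) : Prop :=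
  IsGermDefining S ξ ∧
  ∀ g ∈ Subgroup.closure S, g ξ = ξ → AccPt ξ (𝓟 (interior {x | g x = x}))

end Germs

section Fragmentations

/-- `F` is a fragmentation of the finite order homeomorphism `h` with respect to the finite
partition `Q` of the support `{x | h x ≠ x}` into `h`-invariant open sets. -/
structure IsFragmentation {X : Type*} [TopologicalSpace X] (F : Subgroup (X ≃ₜ X)) (h : X ≃ₜ X)
    (Q : Set (Set X)) : Prop where
  finite_order : IsOfFinOrder h
  finite_pieces : Q.Finite
  nonempty_pieces : ∀ P ∈ Q, P.Nonempty
  disjoint_pieces : Q.PairwiseDisjoint id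
  cover : ⋃₀ Q = {x | h x ≠ x}
  open_pieces : ∀ P ∈ Q, IsOpen P
  invariant_pieces : ∀ P ∈ Q, h '' P = P
  finite_group : Finite F
  local_power : ∀ g ∈ F, ∀ P ∈ Q, ∃ k : ℤ, Set.EqOn g (h ^ k : X ≃ₜ X) P
  fix : ∀ g ∈ F, ∀ x, h x = x → g x = x
  onto_piece : ∀ P ∈ Q, ∀ k : ℤ, ∃ g ∈ F, Set.EqOn g (h ^ k : X ≃ₜ X) P

/-- `G` is a fragmentation group of the group generated by `S`: it is generated by the union of
fragmentations `F s` of the generators `s ∈ S`. -/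
def IsFragmentationGroup {X : Type*} [TopologicalSpace X] (S : Set (X ≃ₜ X))
    (G : Subgroup (X ≃ₜ X)) : Prop :=
  ∃ F : (X ≃ₜ X) → Subgroup (X ≃ₜ X),
    (∀ s ∈ S, ∃ Q : Set (Set X), IsFragmentation (F s) s Q) ∧ G = ⨆ s ∈ S, F s

end Fragmentations

section Example

/-- The space `{0,1}^ω` of left-infinite words `… x₂ x₁ x₀` over `{0,1}` with the product
topology; `w 0` is the last (rightmost) letter of `w`. -/
abbrev Word : Type := ℕ → Fin 2

/-- The word `v` with its last letter removed: `v x ↦ v`. -/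
def init (w : Word) : Word := fun n => w (n + 1)

/-- The word `v x`, obtained by appending the letter `x` on the right. -/
def snoc (v : Word) (x : Fin 2) : Word
  | 0 => x
  | n + 1 => v n

/-- `g = σ (s 0, s 1)` in the notation of wreath recursions: `(v x) · g = (v · s x) (σ x)`. -/
def HasWreathRecursion (g : Word ≃ₜ Word) (σ : Equiv.Perm (Fin 2)) (s : Fin 2 → (Word ≃ₜ Word)) :
    Prop :=
  ∀ (v : Word) (x : Fin 2), g (snoc v x) = snoc (s x v) (σ x)

/-- The action of `a`: change the last letter. -/
def aFun (w : Word) : Word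
  | 0 => w 0 + 1
  | n + 1 => w (n + 1)

/-- The action of `b = (1, a)`. -/
def bFun (w : Word) : Word
  | 0 => w 0
  | n + 1 => if w 0 = 0 then w (n + 1) else aFun (init w) n

/-- The `n`-th letter of the image of a word under `c = (c, b)`. -/
def cLetter : ℕ → Word → Fin 2
  | 0, w => w 0
  | n + 1, w => if w 0 = 0 then cLetter n (init w) else bFun (init w) n

/-- The action of `c = (c, b)`. -/
def cFun (w : Word) : Word := fun n => cLetter n w

/-- `W n = {0,1}^ω 1 0^n`. -/
def W (n : ℕ) : Set Word := {w | (∀ k < n, w k = 0) ∧ w n = 1}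

/-- The pieces `P j = ⋃ k, W (3 k + j)`. -/
def piece (j : Fin 3) : Set Word := ⋃ k : ℕ, W (3 * k + j)

open Classical in
/-- Act as `c` on `A` and trivially elsewhere. -/
noncomputable def fragFun (A : Set Word) (w : Word) : Word := if w ∈ A then cFun w else w

/-- `A` contains or avoids each `W n`. -/
def Saturated (A : Set Word) : Prop :=
  ∀ (n : ℕ) (w w' : Word), w ∈ W n → w' ∈ W n → w ∈ A → w' ∈ A

theorem fin2_add (x : Fin 2) : x + 1 + 1 = x := by fin_cases x <;> rfl

theorem fin2_ne (x : Fin 2) (h : x ≠ 0) : x = 1 := by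
  fin_cases x
  · exact absurd rfl h
  · rfl

theorem W_unique {m n : ℕ} {w : Word} (hm : w ∈ W m) (hn : w ∈ W n) : m = n := by
  rcases lt_trichotomy m n with h | h | h
  · have := hn.1 m h; rw [hm.2] at this; exact absurd this (by decide)
  · exact h
  · have := hm.1 n h; rw [hn.2] at this; exact absurd this (by decide)

theorem piece_union_saturated (i j : Fin 3) : Saturated (piece i ∪ piece j) := by
  intro n w w' hw hw' h
  rcases h with h | h
  · left
    obtain ⟨k, hk⟩ := Set.mem_iUnion.1 h
    exact Set.mem_iUnion.2 ⟨k, by rwa [← W_unique hw hk]⟩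
  · right
    obtain ⟨k, hk⟩ := Set.mem_iUnion.1 h
    exact Set.mem_iUnion.2 ⟨k, by rwa [← W_unique hw hk]⟩

theorem aFun_aFun (w : Word) : aFun (aFun w) = w := by
  funext n
  cases n with
  | zero => exact fin2_add _
  | succ n => rfl

theorem bFun_bFun (w : Word) : bFun (bFun w) = w := by
  funext n
  cases n with
  | zero => rfl
  | succ n =>
    by_cases h : w 0 = 0
    · simp [bFun, h]
    · have h1 : init (bFun w) = aFun (init w) := by funext k; simp [init, bFun, h]
      have h2 : bFun w 0 = w 0 := rfl
      change (if bFun w 0 = 0 then _ else aFun (init (bFun w)) n) = _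
      rw [h2, if_neg h, h1, aFun_aFun]
      rfl

theorem init_cFun_zero {w : Word} (h : w 0 = 0) : init (cFun w) = cFun (init w) := by
  funext k; simp [init, cFun, cLetter, h]

theorem init_cFun_one {w : Word} (h : w 0 ≠ 0) : init (cFun w) = bFun (init w) := by
  funext k; simp [init, cFun, cLetter, h]

theorem cFun_cFun (w : Word) : cFun (cFun w) = w := by
  funext n
  induction n generalizing w with
  | zero => rfl
  | succ n ih =>
    have h2 : cFun w 0 = w 0 := rfl
    change (if cFun w 0 = 0 then cFun (init (cFun w)) n else bFun (init (cFun w)) n) = _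
    by_cases h : w 0 = 0
    · rw [h2, if_pos h, init_cFun_zero h, ih]; rfl
    · rw [h2, if_neg h, init_cFun_one h, bFun_bFun]; rfl

theorem cFun_mem_W {m : ℕ} {w : Word} (hw : w ∈ W m) : cFun w ∈ W m := by
  induction m generalizing w with
  | zero => exact ⟨fun k hk => absurd hk (Nat.not_lt_zero k), hw.2⟩
  | succ m ih =>
    have h0 : w 0 = 0 := hw.1 0 (Nat.succ_pos m)
    have hi : init w ∈ W m := ⟨fun k hk => hw.1 (k + 1) (Nat.succ_lt_succ hk), hw.2⟩
    have h := ih hi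
    rw [← init_cFun_zero h0] at h
    refine ⟨fun k hk => ?_, h.2⟩
    cases k with
    | zero => exact h0
    | succ k => exact h.1 k (Nat.lt_of_succ_lt_succ hk)

theorem exists_W {w : Word} {n : ℕ} (h : ¬ ∀ k ≤ n, w k = 0) : ∃ m ≤ n, w ∈ W m := by
  classical
  push Not at h
  obtain ⟨k, hk, hk'⟩ := h
  have hex : ∃ m, w m ≠ 0 := ⟨k, hk'⟩
  exact ⟨Nat.find hex, (Nat.find_min' hex hk').trans hk,
    fun j hj => not_not.1 (Nat.find_min hex hj), fin2_ne _ (Nat.find_spec hex)⟩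

theorem cFun_zero {w : Word} {n : ℕ} (h : ∀ k ≤ n, w k = 0) : cFun w n = 0 := by
  induction n generalizing w with
  | zero => exact h 0 le_rfl
  | succ n ih =>
    change (if w 0 = 0 then cFun (init w) n else _) = _
    rw [if_pos (h 0 (Nat.zero_le _))]
    exact ih fun k hk => h (k + 1) (Nat.succ_le_succ hk)

theorem fragFun_fragFun {A : Set Word} (hA : Saturated A) (w : Word) :
    fragFun A (fragFun A w) = w := by
  by_cases hw : w ∈ A
  · have h1 : fragFun A w = cFun w := if_pos hw
    have h2 : cFun w ∈ A := by
      by_cases h0 : ∀ k, w k = 0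
      · have : cFun w = w := by
          funext n
          rw [cFun_zero fun k _ => h0 k, h0 n]
        rwa [this]
      · push Not at h0
        obtain ⟨n, hn⟩ := h0
        obtain ⟨m, -, hm⟩ := exists_W (n := n) fun h => hn (h n le_rfl)
        exact hA m _ _ hm (cFun_mem_W hm) hw
    rw [h1, fragFun, if_pos h2, cFun_cFun]
  · have h1 : fragFun A w = w := if_neg hw
    rw [h1, h1]

theorem aFun_local {n : ℕ} {w w' : Word} (h : ∀ k ≤ n, w k = w' k) : aFun w n = aFun w' n := by
  cases n with
  | zero => simp [aFun, h 0 le_rfl]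
  | succ n => exact h _ le_rfl

theorem init_local {n : ℕ} {w w' : Word} (h : ∀ k ≤ n + 1, w k = w' k) :
    ∀ k ≤ n, init w k = init w' k := fun k hk => h (k + 1) (Nat.succ_le_succ hk)

theorem bFun_local {n : ℕ} {w w' : Word} (h : ∀ k ≤ n, w k = w' k) : bFun w n = bFun w' n := by
  cases n with
  | zero => exact h 0 le_rfl
  | succ n =>
    simp [bFun, h 0 (Nat.zero_le _), h (n + 1) le_rfl, aFun_local (init_local h)]

theorem cFun_local {n : ℕ} {w w' : Word} (h : ∀ k ≤ n, w k = w' k) : cFun w n = cFun w' n := by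
  induction n generalizing w w' with
  | zero => exact h 0 le_rfl
  | succ n ih =>
    change (if w 0 = 0 then cFun (init w) n else _) = if w' 0 = 0 then cFun (init w') n else _
    rw [ih (init_local h), h 0 (Nat.zero_le _), bFun_local (init_local h)]

theorem fragFun_local {A : Set Word} (hA : Saturated A) {n : ℕ} {w w' : Word}
    (h : ∀ k ≤ n, w k = w' k) : fragFun A w n = fragFun A w' n := by
  by_cases h0 : ∀ k ≤ n, w k = 0
  · have h0' : ∀ k ≤ n, w' k = 0 := fun k hk => (h k hk).symm.trans (h0 k hk)
    have key : ∀ u : Word, (∀ k ≤ n, u k = 0) → fragFun A u n = 0 := by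
      intro u hu
      by_cases hu' : u ∈ A
      · rw [fragFun, if_pos hu', cFun_zero hu]
      · rw [fragFun, if_neg hu', hu n le_rfl]
    rw [key w h0, key w' h0']
  · obtain ⟨m, hmn, hm⟩ := exists_W h0
    have hm' : w' ∈ W m :=
      ⟨fun k hk => (h k (hk.le.trans hmn)).symm.trans (hm.1 k hk), (h m hmn).symm.trans hm.2⟩
    by_cases hw : w ∈ A
    · rw [fragFun, fragFun, if_pos hw, if_pos (hA m _ _ hm hm' hw), cFun_local h]
    · rw [fragFun, fragFun, if_neg hw, if_neg fun hw' => hw (hA m _ _ hm' hm hw'), h n le_rfl]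

theorem continuous_of_local {f : Word → Word}
    (hf : ∀ (n : ℕ) (w w' : Word), (∀ k ≤ n, w k = w' k) → f w n = f w' n) : Continuous f := by
  refine continuous_pi fun n => ?_
  refine IsLocallyConstant.continuous ?_
  rw [IsLocallyConstant.iff_eventually_eq]
  intro w
  have hev : ∀ᶠ w' in 𝓝 w, ∀ k ∈ Finset.range (n + 1), w' k = w k := by
    rw [Filter.eventually_all_finset]
    intro k _
    have := (continuous_apply k).tendsto w (IsOpen.mem_nhds (isOpen_discrete {w k}) rfl)
    exact this
  filter_upwards [hev] with w' hw'
  exact hf n _ _ fun k hk => hw' k (Finset.mem_range.2 (Nat.lt_succ_of_le hk))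

/-- An involution that respects prefixes, as a homeomorphism. -/
def ofInvolution (f : Word → Word) (hf : ∀ w, f (f w) = w)
    (hloc : ∀ (n : ℕ) (w w' : Word), (∀ k ≤ n, w k = w' k) → f w n = f w' n) : Word ≃ₜ Word where
  toFun := f
  invFun := f
  left_inv := hf
  right_inv := hf
  continuous_toFun := continuous_of_local hloc
  continuous_invFun := continuous_of_local hloc

/-- `a = σ`. -/
def a : Word ≃ₜ Word := ofInvolution aFun aFun_aFun fun _ _ _ => aFun_local

/-- `b = (1, a)`. -/
def b : Word ≃ₜ Word := ofInvolution bFun bFun_bFun fun _ _ _ => bFun_local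

/-- `c = (c, b)`. -/
def c : Word ≃ₜ Word := ofInvolution cFun cFun_cFun fun _ _ _ => cFun_local

/-- The homeomorphism that acts as `c` on `P i ∪ P j` and trivially elsewhere. -/
noncomputable def cOn (i j : Fin 3) : Word ≃ₜ Word :=
  ofInvolution (fragFun (piece i ∪ piece j)) (fragFun_fragFun (piece_union_saturated i j))
    fun _ _ _ => fragFun_local (piece_union_saturated i j)

/-- `c₀` acts as `c` on `P₀ ∪ P₁`. -/
noncomputable def c₀ : Word ≃ₜ Word := cOn 0 1

/-- `c₁` acts as `c` on `P₀ ∪ P₂`. -/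
noncomputable def c₁ : Word ≃ₜ Word := cOn 0 2

/-- `c₂` acts as `c` on `P₁ ∪ P₂`. -/
noncomputable def c₂ : Word ≃ₜ Word := cOn 1 2

theorem wreath_a : HasWreathRecursion a (Equiv.swap 0 1) ![1, 1] := by
  intro v x
  funext n
  fin_cases x <;> cases n <;> rfl

theorem wreath_b : HasWreathRecursion b 1 ![1, a] := by
  intro v x
  funext n
  fin_cases x <;> cases n <;> rfl

theorem wreath_c : HasWreathRecursion c 1 ![c, b] := by
  intro v x
  funext n
  fin_cases x <;> cases n <;> rfl

/-- The generating set `{a, b, c₀, c₁, c₂}`. -/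
def gens : Set (Word ≃ₜ Word) := {a, b, c₀, c₁, c₂}

/-- The group `G = ⟨a, b, c₀, c₁, c₂⟩`. -/
def G : Subgroup (Word ≃ₜ Word) := Subgroup.closure gens

/-- The group `⟨c₀, c₁, c₂⟩`. -/
def H : Subgroup (Word ≃ₜ Word) := Subgroup.closure {c₀, c₁, c₂}

/-- The point `0^ω`. -/
def zeroWord : Word := fun _ => 0

theorem gens_finite : gens.Finite := by
  simp [gens]

end Example

end FragK110

/-!
Indexed by `ℤ/3`, the generators satisfy `c i * c j = c (-(i + j))` for `i ≠ j`, because `c i` is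
`c` away from one of three pieces and trivial on that piece. So `H` is a Klein four group. All three
pieces accumulate on `0^ω`, so no `c i` is trivial near `0^ω`, but the interior of its fixed point
set accumulates there. View words as elements of the group `(ℤ/2)^ω`. Near every point other than
`0^ω` each generator is a translation, and so are `a` and `b` near `0^ω`. Hence every `g ∈ G` is
near `0^ω` an element of `H` followed by a translation, and a product of generators along a cycle
which moves the point at each step is a translation near that point, hence has trivial germ.

For the growth, give each pair of neighbouring letters of a word a weight: their two base prices,
plus a toll of `2` if they occur as sections at different places of the wreath recursion. Cancelling
and merging letters does not raise the weight. In a reduced word the sections of `b` and `c i`, and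
the moves between the two places caused by `a`, are paid for by `η` times the weight exactly if
`2 ≤ η * base a = η^5 + η^4 + η^3`. So the wreath recursion replaces a word by two words of total
weight at most `η` times the original one. Iterating it describes an element of length at most `R`
by a binary tree with labels from a finite set. By concavity of `x ^ α` this tree has `O(R ^ α)`
nodes as soon as `2 * (η / 2) ^ α < 1`, which means `log 2 / (log 2 - log η) < α`.
-/

namespace FragK110

section General

variable {X : Type*} [TopologicalSpace X]

theorem isFragmentation_zpowers [T2Space X] {h : X ≃ₜ X} (hfin : IsOfFinOrder h) (hne : h ≠ 1) :
    IsFragmentation (Subgroup.zpowers h) h {{x | h x ≠ x}} where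
  finite_order := hfin
  finite_pieces := Set.finite_singleton _
  nonempty_pieces := by
    rintro _ rfl
    by_contra! hempty
    exact hne (Homeomorph.ext fun x => by_contra fun hx => hempty.le hx)
  disjoint_pieces := Set.pairwiseDisjoint_singleton _ _
  cover := Set.sUnion_singleton _
  open_pieces := by
    rintro _ rfl
    exact isOpen_ne_fun h.continuous continuous_id
  invariant_pieces := by
    rintro _ rfl
    rw [h.image_eq_preimage_symm]
    ext x
    change h (h.symm x) ≠ h.symm x ↔ h x ≠ x
    rw [h.apply_symm_apply, ne_comm, ne_eq, h.symm_apply_eq, eq_comm, ne_eq]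
  finite_group := finite_zpowers.2 hfin
  local_power := by
    rintro _ ⟨k, rfl⟩ _ -
    exact ⟨k, Set.eqOn_refl _ _⟩
  fix := by
    rintro _ ⟨k, rfl⟩ x hx
    exact ((pointStab ⊤ x).zpow_mem (show h ∈ pointStab ⊤ x from ⟨trivial, hx⟩) k).2
  onto_piece := fun _ _ k => ⟨h ^ k, ⟨k, rfl⟩, Set.eqOn_refl _ _⟩

theorem germGroup_mulEquiv {G K : Subgroup (X ≃ₜ X)} {ζ : X} (hK : K ≤ pointStab G ζ)
    (hgerm : ∀ g ∈ G, g ζ = ζ → ∃! h : X ≃ₜ X, h ∈ K ∧ ∀ᶠ x in 𝓝 ζ, g x = h x) :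
    Nonempty (K ≃* GermGroup G ζ) := by
  let φ : K →* GermGroup G ζ := (QuotientGroup.mk' _).comp (Subgroup.inclusion hK)
  have germ_eq_iff (g h : pointStab G ζ) :
      (g : GermGroup G ζ) = h ↔ ∀ᶠ x in 𝓝 ζ, h.1 x = g.1 x := by
    rw [QuotientGroup.eq, Subgroup.mem_subgroupOf]
    refine (and_iff_right (mul_mem (inv_mem g.2.1) h.2.1)).trans (eventually_congr ?_)
    exact .of_forall fun x => g.1.symm_apply_eq
  refine ⟨MulEquiv.ofBijective φ ⟨fun h h' heq => ?_, fun q => ?_⟩⟩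
  · exact Subtype.ext ((hgerm h' (hK h'.2).1 (hK h'.2).2).unique
      ⟨h.2, (germ_eq_iff _ _).1 heq⟩ ⟨h'.2, .of_forall fun _ => rfl⟩)
  · obtain ⟨g, rfl⟩ := QuotientGroup.mk_surjective q
    obtain ⟨h, ⟨hh, hgh⟩, -⟩ := hgerm g g.2.1 g.2.2
    exact ⟨⟨h, hh⟩, (germ_eq_iff _ _).2 hgh⟩

variable [AddCommGroup X]

/-- `g` coincides near `p` with a translation of the additive group `X`. Being the translation by
`0` near a fixed point means fixing a neighborhood, so a cycle composed of local translations has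
trivial germ. -/
def IsTranslationAt (g : X ≃ₜ X) (p : X) : Prop := ∀ᶠ y in 𝓝 p, g y = y + (g p - p)

namespace IsTranslationAt

variable {g h : X ≃ₜ X} {p t : X}

theorem of_eventually_eq_add (hg : ∀ᶠ y in 𝓝 p, g y = y + t) : IsTranslationAt g p := by
  filter_upwards [hg] with y hy
  rw [hy, hg.self_of_nhds, add_sub_cancel_left]

theorem congr (hg : IsTranslationAt g p) (hgh : ∀ᶠ y in 𝓝 p, h y = g y) :
    IsTranslationAt h p :=
  of_eventually_eq_add (t := g p - p) (by filter_upwards [hg, hgh] with y hy hy'; rw [hy', hy])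

theorem one (p : X) : IsTranslationAt (1 : X ≃ₜ X) p :=
  of_eventually_eq_add (t := 0) (.of_forall fun y => (add_zero y).symm)

theorem mul (hg : IsTranslationAt g (h p)) (hh : IsTranslationAt h p) :
    IsTranslationAt (g * h) p := by
  filter_upwards [hh, (h.continuous.tendsto p).eventually hg] with y hy hy'
  rw [Homeomorph.mul_apply, Homeomorph.mul_apply, hy', hy]
  abel

theorem eventually_eq_self (hg : IsTranslationAt g p) (hp : g p = p) : ∀ᶠ y in 𝓝 p, g y = y := by
  filter_upwards [hg] with y hy
  rw [hy, hp, sub_self, add_zero]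

theorem prod_of_forall_ne {S : Set (X ≃ₜ X)}
    (hS : ∀ s, s ∈ S ∨ s⁻¹ ∈ S → ∀ p, s p ≠ p → IsTranslationAt s p) :
    ∀ l : List (X ≃ₜ X), (∀ s ∈ l, s ∈ S ∨ s⁻¹ ∈ S) →
      (∀ i < l.length, (l.drop i).prod p ≠ (l.drop (i + 1)).prod p) → IsTranslationAt l.prod p
  | [], _, _ => one p
  | s :: l, hl, hne => by
    rw [List.forall_mem_cons] at hl
    have hs : s (l.prod p) ≠ l.prod p := by simpa using hne 0 (by simp)
    have htail : ∀ i < l.length, (l.drop i).prod p ≠ (l.drop (i + 1)).prod p :=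
      fun i hi => by simpa using hne (i + 1) (by simpa using hi)
    exact (hS s hl.1 _ hs).mul (prod_of_forall_ne hS l hl.2 htail)

end IsTranslationAt

theorem IsNonloopCycle.eventually_prod_eq_self {S : Set (X ≃ₜ X)}
    (hS : ∀ s, s ∈ S ∨ s⁻¹ ∈ S → ∀ p, s p ≠ p → IsTranslationAt s p) {p : X}
    {l : List (X ≃ₜ X)} (hl : IsNonloopCycle S p l) : ∀ᶠ x in 𝓝 p, l.prod x = x := by
  obtain ⟨hlen, hmem, hinj, hprod⟩ := hl
  refine (IsTranslationAt.prod_of_forall_ne hS l hmem fun i hi heq => ?_).eventually_eq_self hprod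
  rcases i.eq_zero_or_pos with rfl | hpos
  · have hfirst : (l.drop 1).prod p = (l.drop l.length).prod p := by
      rw [← heq, List.drop_zero, hprod, List.drop_length, List.prod_nil, Homeomorph.one_apply]
    have := hinj ⟨le_rfl, by lia⟩ ⟨by lia, le_rfl⟩ hfirst
    lia
  · have := hinj ⟨hpos, hi.le⟩ ⟨by lia, hi⟩ heq
    lia

end General

section Words

open scoped Fin.CommRing

variable {w : Word} {m n : ℕ} {i j : Fin 3}

theorem snoc_init (w : Word) : snoc (init w) (w 0) = w :=
  funext fun n => by cases n <;> rfl

theorem exists_snoc (w : Word) : ∃ v x, w = snoc v x := ⟨_, _, (snoc_init w).symm⟩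

theorem snoc_zeroWord_zero : snoc zeroWord 0 = zeroWord := snoc_init zeroWord

theorem snoc_add_single (v : Word) (x t : Fin 2) (n : ℕ) :
    snoc (v + Pi.single n t) x = snoc v x + Pi.single (n + 1) t := by
  funext k
  cases k <;> simp [snoc, Pi.single_apply]

theorem snoc_mem_W_zero {v : Word} {x : Fin 2} : snoc v x ∈ W 0 ↔ x = 1 :=
  and_iff_right fun _ hk => absurd hk (Nat.not_lt_zero _)

theorem snoc_mem_W_succ {v : Word} {x : Fin 2} : snoc v x ∈ W (n + 1) ↔ x = 0 ∧ v ∈ W n := by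
  refine Iff.trans (and_congr_left' ?_) and_assoc
  exact Nat.forall_lt_succ_left (p := fun k => snoc v x k = 0)

theorem eq_zeroWord_or_mem_W (w : Word) : w = zeroWord ∨ ∃ n, w ∈ W n := by
  refine or_iff_not_imp_left.2 fun hw => ?_
  obtain ⟨n, hn⟩ := Function.ne_iff.1 hw
  obtain ⟨m, -, hm⟩ := exists_W (n := n) fun h => hn (h n le_rfl)
  exact ⟨m, hm⟩

theorem mem_piece_iff (hw : w ∈ W n) : w ∈ piece j ↔ (n : Fin 3) = j := by
  rw [Fin.ext_iff, Fin.val_natCast]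
  constructor
  · intro h
    obtain ⟨k, hk⟩ := Set.mem_iUnion.1 h
    have := W_unique hw hk
    lia
  · intro h
    exact Set.mem_iUnion.2 ⟨n / 3, by rwa [← h, Nat.div_add_mod]⟩

theorem exists_mem_W_of_mem_piece (hw : w ∈ piece j) : ∃ n : ℕ, w ∈ W n ∧ (n : Fin 3) = j := by
  obtain ⟨k, hk⟩ := Set.mem_iUnion.1 hw
  exact ⟨_, hk, (mem_piece_iff hk).1 hw⟩

theorem zeroWord_notMem_piece : zeroWord ∉ piece j := fun h =>
  have ⟨_, hn, _⟩ := exists_mem_W_of_mem_piece h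
  absurd hn.2 zero_ne_one

theorem eventually_apply_eq (w : Word) (n : ℕ) : ∀ᶠ y in 𝓝 w, y n = w n :=
  (continuous_apply n).tendsto w (isOpen_discrete {w n} |>.mem_nhds rfl)

theorem isOpen_W (n : ℕ) : IsOpen (W n) := by
  refine isOpen_iff_mem_nhds.2 fun w hw => ?_
  have hzeros : ∀ᶠ y in 𝓝 w, ∀ k ∈ Set.Iio n, y k = w k :=
    (eventually_all_finite (Set.finite_Iio n)).2 fun k _ => eventually_apply_eq w k
  filter_upwards [hzeros, eventually_apply_eq w n] with y hy hyn
  exact ⟨fun k hk => (hy k hk).trans (hw.1 k hk), hyn.trans hw.2⟩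

theorem isOpen_piece (j : Fin 3) : IsOpen (piece j) := isOpen_iUnion fun _ => isOpen_W _

/-- The word `0^ω 1 1 0^n`. It lies in `W n`, is moved by `c`, and tends to `0^ω`. -/
def testWord (n : ℕ) : Word := Pi.single n 1 + Pi.single (n + 1) 1

theorem testWord_apply_succ (n : ℕ) : testWord n (n + 1) = 1 := by
  simp [testWord]

theorem testWord_mem_W (n : ℕ) : testWord n ∈ W n := by
  refine ⟨fun k hk => ?_, by simp [testWord]⟩
  simp [testWord, hk.ne, (hk.trans n.lt_succ_self).ne]

theorem tendsto_testWord : Tendsto testWord atTop (𝓝 zeroWord) := by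
  refine tendsto_pi_nhds.2 fun k => tendsto_const_nhds.congr' ?_
  filter_upwards [eventually_gt_atTop k] with n hn
  exact ((testWord_mem_W n).1 k hn).symm

end Words

section Generators

open scoped Fin.CommRing

variable {w p : Word} {n : ℕ} {i j : Fin 3} {h h' g s : Word ≃ₜ Word}

theorem a_apply (w : Word) : a w = w + Pi.single 0 1 := by
  funext n
  cases n
  · rfl
  · exact (add_zero _).symm

theorem a_mul_a : a * a = 1 := Homeomorph.ext aFun_aFun

theorem b_apply (w : Word) : b w = w + Pi.single 1 (w 0) := by
  obtain ⟨v, x, rfl⟩ := exists_snoc w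
  refine (wreath_b v x).trans (.trans (congrArg (snoc · x) ?_) (snoc_add_single v x x 0))
  fin_cases x
  · simp
  · exact a_apply v

theorem b_mul_b : b * b = 1 := Homeomorph.ext bFun_bFun

theorem c_apply (hw : w ∈ W n) : c w = w + Pi.single (n + 2) (w (n + 1)) := by
  induction n generalizing w with
  | zero =>
    obtain ⟨v, x, rfl⟩ := exists_snoc w
    obtain rfl := snoc_mem_W_zero.1 hw
    exact (wreath_c v 1).trans ((congrArg (snoc · 1) (b_apply v)).trans (snoc_add_single ..))
  | succ n ih =>
    obtain ⟨v, x, rfl⟩ := exists_snoc w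
    obtain ⟨rfl, hv⟩ := snoc_mem_W_succ.1 hw
    exact (wreath_c v 0).trans ((congrArg (snoc · 0) (ih hv)).trans (snoc_add_single ..))

theorem c_zeroWord : c zeroWord = zeroWord := funext fun _ => cFun_zero fun _ _ => rfl

theorem c_mul_c : c * c = 1 := Homeomorph.ext cFun_cFun

theorem c_mem_W (hw : w ∈ W n) : c w ∈ W n := cFun_mem_W hw

theorem c_testWord_ne (n : ℕ) : c (testWord n) ≠ testWord n := by
  rw [c_apply (testWord_mem_W n), testWord_apply_succ, ne_eq, add_eq_left, Pi.single_eq_zero_iff]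
  exact one_ne_zero

/-- The generators `c₀`, `c₁`, `c₂`, indexed by `ℤ/3`. Since `cGen i` is `c` restricted to the
complement of `piece (2 - i)`, both the products and the wreath recursions become arithmetic
in `ℤ/3`. -/
noncomputable def cGen : Fin 3 → (Word ≃ₜ Word) := ![c₀, c₁, c₂]

theorem cOn_apply (hw : w ∈ W n) :
    cOn i j w = if (n : Fin 3) = i ∨ (n : Fin 3) = j then c w else w := by
  have hunion : w ∈ piece i ∪ piece j ↔ _ := or_congr (mem_piece_iff hw) (mem_piece_iff hw)
  split_ifs with h
  · exact if_pos (hunion.2 h)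
  · exact if_neg (mt hunion.1 h)

theorem cGen_apply (hw : w ∈ W n) : cGen i w = if (n : Fin 3) = 2 - i then w else c w := by
  obtain ⟨j, k, hjk, hi⟩ : ∃ j k, cGen i = cOn j k ∧ ∀ m, (m = j ∨ m = k) ↔ m ≠ 2 - i := by
    fin_cases i
    exacts [⟨0, 1, rfl, by decide⟩, ⟨0, 2, rfl, by decide⟩, ⟨1, 2, rfl, by decide⟩]
  rw [hjk, cOn_apply hw, if_congr (hi n) rfl rfl, ite_not]

theorem cGen_zeroWord (i : Fin 3) : cGen i zeroWord = zeroWord := by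
  fin_cases i <;> exact if_neg fun h => h.elim zeroWord_notMem_piece zeroWord_notMem_piece

theorem wreath_cGen (i : Fin 3) :
    HasWreathRecursion (cGen i) 1 ![cGen (i + 1), if i = 2 then 1 else b] := by
  intro v x
  fin_cases x
  · change cGen i (snoc v 0) = snoc (cGen (i + 1) v) 0
    obtain rfl | ⟨n, hv⟩ := eq_zeroWord_or_mem_W v
    · rw [snoc_zeroWord_zero, cGen_zeroWord, cGen_zeroWord, snoc_zeroWord_zero]
    · have hshift : (((n + 1 : ℕ) : Fin 3) = 2 - i) ↔ (n : Fin 3) = 2 - (i + 1) := by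
        rw [Nat.cast_succ]
        generalize (n : Fin 3) = m
        decide +revert
      rw [cGen_apply hv, cGen_apply (snoc_mem_W_succ.2 ⟨rfl, hv⟩), apply_ite (snoc · 0)]
      exact if_congr hshift rfl (wreath_c v 0)
  · change cGen i (snoc v 1) = snoc ((if i = 2 then 1 else b) v) 1
    have hpiece : ((0 : ℕ) : Fin 3) = 2 - i ↔ i = 2 := by decide +revert
    rw [cGen_apply (snoc_mem_W_zero.2 rfl), if_congr hpiece rfl rfl]
    split_ifs
    · rfl
    · exact wreath_c v 1

theorem wreath_c₀ : HasWreathRecursion c₀ 1 ![c₁, b] := wreath_cGen 0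

theorem wreath_c₁ : HasWreathRecursion c₁ 1 ![c₂, b] := wreath_cGen 1

theorem wreath_c₂ : HasWreathRecursion c₂ 1 ![c₀, 1] := wreath_cGen 2

theorem cGen_mul_self (i : Fin 3) : cGen i * cGen i = 1 := by
  fin_cases i <;> exact Homeomorph.ext (fragFun_fragFun (piece_union_saturated _ _))

theorem cGen_mul_cGen (hij : i ≠ j) : cGen i * cGen j = cGen (-(i + j)) := by
  ext1 w
  rw [Homeomorph.mul_apply]
  obtain rfl | ⟨n, hw⟩ := eq_zeroWord_or_mem_W w
  · simp only [cGen_zeroWord]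
  have hthird : (n : Fin 3) = 2 - -(i + j) ↔ (n : Fin 3) ≠ 2 - i ∧ (n : Fin 3) ≠ 2 - j := by
    generalize (n : Fin 3) = m
    decide +revert
  have hcw : cGen i (c w) = if (n : Fin 3) = 2 - i then c w else w := by
    rw [cGen_apply (c_mem_W hw)]
    exact if_congr .rfl rfl (cFun_cFun w)
  rw [cGen_apply hw (i := j), cGen_apply hw (i := -(i + j)), apply_ite (cGen i), hcw,
    cGen_apply hw, if_congr hthird rfl rfl]
  have hne : (2 : Fin 3) - i ≠ 2 - j := sub_right_injective.ne hij
  grind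

theorem cGen_testWord_eq_iff (n : ℕ) :
    cGen i (testWord n) = testWord n ↔ (n : Fin 3) = 2 - i := by
  rw [cGen_apply (testWord_mem_W n)]
  exact ite_eq_left_iff.trans (not_imp_comm.trans (imp_iff_right (c_testWord_ne n)))

theorem not_eventually_cGen_eq_self (i : Fin 3) : ¬ ∀ᶠ x in 𝓝 zeroWord, cGen i x = x := by
  intro hfix
  have hnat := (tendsto_testWord.eventually hfix).mono fun n => (cGen_testWord_eq_iff n).1
  obtain ⟨n, hn, hsucc⟩ := (hnat.and ((tendsto_add_atTop_nat 1).eventually hnat)).exists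
  rw [Nat.cast_succ, hn, add_eq_left] at hsucc
  exact one_ne_zero hsucc

theorem cGen_ne_one (i : Fin 3) : cGen i ≠ 1 := fun h =>
  not_eventually_cGen_eq_self i (.of_forall fun x => by rw [h, Homeomorph.one_apply])

theorem cGen_injective : Function.Injective cGen := fun i j heq => by
  by_contra hij
  exact cGen_ne_one _ ((cGen_mul_cGen hij).symm.trans (heq ▸ cGen_mul_self i))

theorem forall_mem_gens {P : (Word ≃ₜ Word) → Prop} :
    (∀ s ∈ gens, P s) ↔ P a ∧ P b ∧ ∀ i, P (cGen i) := by
  simp [gens, cGen, Fin.forall_fin_succ]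

theorem cGen_mem_gens (i : Fin 3) : cGen i ∈ gens := (forall_mem_gens.1 fun _ hs => hs).2.2 i

theorem inv_eq_self_of_mem_gens (hs : s ∈ gens) : s⁻¹ = s :=
  inv_eq_of_mul_eq_one_left
    (forall_mem_gens (P := fun s => s * s = 1).2 ⟨a_mul_a, b_mul_b, cGen_mul_self⟩ s hs)

theorem mem_gens_of_mem_or_inv_mem (hs : s ∈ gens ∨ s⁻¹ ∈ gens) : s ∈ gens :=
  hs.elim id fun hinv => inv_inv s ▸ (inv_eq_self_of_mem_gens hinv).symm ▸ hinv

end Generators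

section FragmentedGenerator

open scoped Fin.CommRing

variable {w : Word} {n : ℕ} {i j : Fin 3} {g h h' : Word ≃ₜ Word}

theorem coe_H : (H : Set (Word ≃ₜ Word)) = Set.range fun o : Option (Fin 3) => o.elim 1 cGen := by
  let K : Subgroup (Word ≃ₜ Word) :=
    { carrier := Set.range fun o : Option (Fin 3) => o.elim 1 cGen
      one_mem' := ⟨none, rfl⟩
      mul_mem' := by
        rintro _ _ ⟨_ | i, rfl⟩ ⟨_ | j, rfl⟩
        · exact ⟨none, (one_mul 1).symm⟩
        · exact ⟨some j, (one_mul _).symm⟩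
        · exact ⟨some i, (mul_one _).symm⟩
        · obtain rfl | hij := eq_or_ne i j
          · exact ⟨none, (cGen_mul_self i).symm⟩
          · exact ⟨some (-(i + j)), (cGen_mul_cGen hij).symm⟩
      inv_mem' := by
        rintro _ ⟨_ | i, rfl⟩
        · exact ⟨none, inv_one.symm⟩
        · exact ⟨some i, (inv_eq_of_mul_eq_one_left (cGen_mul_self i)).symm⟩ }
  have hgen : ∀ i, cGen i ∈ H := by
    intro i
    refine Subgroup.subset_closure ?_
    fin_cases i
    exacts [.inl rfl, .inr (.inl rfl), .inr (.inr rfl)]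
  refine Set.Subset.antisymm (show H ≤ K from (Subgroup.closure_le K).2 ?_) ?_
  · rintro _ (rfl | rfl | rfl)
    exacts [⟨some 0, rfl⟩, ⟨some 1, rfl⟩, ⟨some 2, rfl⟩]
  · rintro _ ⟨_ | i, rfl⟩
    exacts [H.one_mem, hgen i]

theorem mem_H_iff : h ∈ H ↔ h = 1 ∨ ∃ i, h = cGen i := by
  rw [← SetLike.mem_coe, coe_H, Set.mem_range, Option.exists]
  simp only [Option.elim, eq_comm]

theorem cGen_mem_H (i : Fin 3) : cGen i ∈ H := mem_H_iff.2 (.inr ⟨i, rfl⟩)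

theorem H_apply_eq_self (hh : h ∈ H) (hw : c w = w) : h w = w := by
  obtain rfl | ⟨i, rfl⟩ := mem_H_iff.1 hh
  · rfl
  obtain rfl | ⟨n, hn⟩ := eq_zeroWord_or_mem_W w
  · exact cGen_zeroWord i
  · rw [cGen_apply hn, hw, ite_self]

theorem H_apply_zeroWord (hh : h ∈ H) : h zeroWord = zeroWord := H_apply_eq_self hh c_zeroWord

theorem finite_H : Finite H := by
  change Finite (H : Set (Word ≃ₜ Word))
  exact coe_H ▸ Set.finite_range _

theorem card_H : Nat.card H = 4 := by
  have hinj : Function.Injective fun o : Option (Fin 3) => o.elim 1 cGen := by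
    rintro (_ | i) (_ | j) h
    exacts [rfl, absurd h.symm (cGen_ne_one j), absurd h (cGen_ne_one i),
      congrArg some (cGen_injective h)]
  change Nat.card (H : Set (Word ≃ₜ Word)) = 4
  rw [coe_H, Nat.card_range_of_injective hinj, Nat.card_eq_fintype_card]
  rfl

theorem isKleinFour_H : IsKleinFour H where
  card_four := card_H
  exponent_two := by
    have := finite_H
    have : Nontrivial H := Finite.one_lt_card_iff_nontrivial.1 (by rw [card_H]; norm_num)
    refine (Monoid.exponent_eq_prime_iff Nat.prime_two).2 fun h hne => ?_
    refine orderOf_eq_prime (Subtype.ext ?_) hne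
    obtain h1 | ⟨i, hi⟩ := mem_H_iff.1 h.2
    · exact absurd (Subtype.ext h1) hne
    · rw [Subgroup.coe_pow, hi, pow_two, cGen_mul_self, Subgroup.coe_one]

theorem nonempty_H_mulEquiv : Nonempty (H ≃* Multiplicative (ZMod 2 × ZMod 2)) :=
  have := isKleinFour_H
  IsKleinFour.nonempty_mulEquiv

theorem H_eq_of_eventuallyEq (hh : h ∈ H) (hh' : h' ∈ H) (heq : ∀ᶠ x in 𝓝 zeroWord, h x = h' x) :
    h = h' := by
  have hfix : ∀ᶠ x in 𝓝 zeroWord, (h⁻¹ * h') x = x :=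
    heq.mono fun x hx => (congrArg h.symm hx.symm).trans (h.symm_apply_apply x)
  obtain h1 | ⟨i, hi⟩ := mem_H_iff.1 (H.mul_mem (H.inv_mem hh) hh')
  · exact inv_mul_eq_one.1 h1
  · exact absurd (hi ▸ hfix) (not_eventually_cGen_eq_self i)

theorem c_mem_piece_iff : c w ∈ piece j ↔ w ∈ piece j := by
  obtain rfl | ⟨n, hw⟩ := eq_zeroWord_or_mem_W w
  · rw [c_zeroWord]
  · rw [mem_piece_iff hw, mem_piece_iff (c_mem_W hw)]

theorem cGen_eqOn_piece_same (i : Fin 3) : Set.EqOn (cGen i) id (piece (2 - i)) := fun _ hw =>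
  have ⟨_, hn, hpiece⟩ := exists_mem_W_of_mem_piece hw
  (cGen_apply hn).trans (if_pos hpiece)

theorem cGen_eqOn_piece_of_ne (hij : j ≠ 2 - i) : Set.EqOn (cGen i) c (piece j) := fun _ hw =>
  have ⟨_, hn, hpiece⟩ := exists_mem_W_of_mem_piece hw
  (cGen_apply hn).trans (if_neg (hpiece ▸ hij))

theorem c_zpow_eq_one_or_self (k : ℤ) : c ^ k = 1 ∨ c ^ k = c := by
  obtain ⟨m, rfl | rfl⟩ := k.even_or_odd'
  · exact .inl (by rw [zpow_mul, zpow_two, c_mul_c, one_zpow])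
  · exact .inr (by rw [zpow_add_one, zpow_mul, zpow_two, c_mul_c, one_zpow, one_mul])

theorem isOfFinOrder_of_mul_self {Γ : Type*} [Monoid Γ] {x : Γ} (hx : x * x = 1) :
    IsOfFinOrder x :=
  isOfFinOrder_iff_pow_eq_one.2 ⟨2, two_pos, (pow_two x).trans hx⟩

theorem sUnion_range_piece_inter_support :
    ⋃₀ Set.range (fun j => piece j ∩ {w | c w ≠ w}) = {w | c w ≠ w} := by
  rw [Set.sUnion_range, ← Set.iUnion_inter, Set.inter_eq_right]
  intro w hw
  obtain rfl | ⟨n, hn⟩ := eq_zeroWord_or_mem_W w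
  · exact absurd c_zeroWord hw
  · exact Set.mem_iUnion.2 ⟨n, (mem_piece_iff hn).2 rfl⟩

theorem image_c_piece_inter_support (j : Fin 3) :
    c '' (piece j ∩ {w | c w ≠ w}) = piece j ∩ {w | c w ≠ w} := by
  refine (congrFun (Set.image_eq_preimage_of_inverse cFun_cFun cFun_cFun) _).trans ?_
  ext w
  exact and_congr c_mem_piece_iff (not_congr c.injective.eq_iff)

theorem isFragmentation_H :
    IsFragmentation H c (Set.range fun j : Fin 3 => piece j ∩ {w | c w ≠ w}) where
  finite_order := isOfFinOrder_of_mul_self c_mul_c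
  finite_pieces := Set.finite_range _
  nonempty_pieces := Set.forall_mem_range.2 fun j =>
    ⟨testWord j, (mem_piece_iff (testWord_mem_W j)).2 (Fin.cast_val_eq_self j), c_testWord_ne j⟩
  disjoint_pieces := by
    refine (Set.pairwiseDisjoint_range_iff).2 fun i j hne => Set.disjoint_left.2 fun w hi hj => ?_
    obtain ⟨n, hn, rfl⟩ := exists_mem_W_of_mem_piece hi.1
    exact hne (congrArg (piece · ∩ {w | c w ≠ w}) ((mem_piece_iff hn).1 hj.1))
  cover := sUnion_range_piece_inter_support
  open_pieces := Set.forall_mem_range.2 fun j =>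
    (isOpen_piece j).inter (isOpen_ne_fun c.continuous continuous_id)
  invariant_pieces := Set.forall_mem_range.2 image_c_piece_inter_support
  finite_group := finite_H
  local_power := by
    rintro h hh _ ⟨j, rfl⟩
    obtain rfl | ⟨i, rfl⟩ := mem_H_iff.1 hh
    · exact ⟨0, Set.eqOn_refl _ _⟩
    obtain rfl | hij := eq_or_ne j (2 - i)
    · exact ⟨0, (cGen_eqOn_piece_same i).mono Set.inter_subset_left⟩
    · exact ⟨1, (cGen_eqOn_piece_of_ne hij).mono Set.inter_subset_left⟩
  fix := fun _ hh _ => H_apply_eq_self hh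
  onto_piece := by
    rintro _ ⟨j, rfl⟩ k
    obtain hk | hk := c_zpow_eq_one_or_self k <;> rw [hk]
    · exact ⟨1, H.one_mem, Set.eqOn_refl _ _⟩
    · have hj : j ≠ 2 - (1 - j) := by decide +revert
      exact ⟨_, cGen_mem_H (1 - j), (cGen_eqOn_piece_of_ne hj).mono Set.inter_subset_left⟩

theorem a_apply_ne (w : Word) : a w ≠ w := by
  rw [a_apply, ne_eq, add_eq_left, Pi.single_eq_zero_iff]
  exact one_ne_zero

theorem b_single_zero_ne : b (Pi.single 0 1) ≠ Pi.single 0 1 := by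
  rw [b_apply, ne_eq, add_eq_left, Pi.single_eq_zero_iff, Pi.single_eq_same]
  exact one_ne_zero

theorem c_single_zero : c (Pi.single 0 1) = Pi.single 0 1 := by
  have hW : (Pi.single 0 1 : Word) ∈ W 0 := ⟨fun _ hk => absurd hk (Nat.not_lt_zero _), rfl⟩
  rw [c_apply hW]
  simp

theorem isFragmentationGroup_G : IsFragmentationGroup {a, b, c} G := by
  classical
  have ha : a ≠ c := fun h => a_apply_ne zeroWord (h ▸ c_zeroWord)
  have hb : b ≠ c := fun h => b_single_zero_ne (h ▸ c_single_zero)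
  have ha1 : a ≠ 1 := fun h => a_apply_ne zeroWord (by rw [h, Homeomorph.one_apply])
  have hb1 : b ≠ 1 := fun h => b_single_zero_ne (by rw [h, Homeomorph.one_apply])
  refine ⟨fun s => if s = c then H else Subgroup.zpowers s, ?_, ?_⟩
  · rintro s (rfl | rfl | rfl)
    · simp only [if_neg ha]
      exact ⟨_, isFragmentation_zpowers (isOfFinOrder_of_mul_self a_mul_a) ha1⟩
    · simp only [if_neg hb]
      exact ⟨_, isFragmentation_zpowers (isOfFinOrder_of_mul_self b_mul_b) hb1⟩
    · simp only [if_pos]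
      exact ⟨_, isFragmentation_H⟩
  · rw [iSup_insert, iSup_insert, iSup_singleton, if_neg ha, if_neg hb, if_pos rfl,
      Subgroup.zpowers_eq_closure, Subgroup.zpowers_eq_closure, G, H, ← Subgroup.closure_union,
      ← Subgroup.closure_union]
    rfl

end FragmentedGenerator

section Singularity

open scoped Fin.CommRing

variable {p : Word} {g h s : Word ≃ₜ Word}

theorem isTranslationAt_a (p : Word) : IsTranslationAt a p :=
  .of_eventually_eq_add (.of_forall a_apply)

theorem isTranslationAt_b (p : Word) : IsTranslationAt b p :=
  .of_eventually_eq_add ((eventually_apply_eq p 0).mono fun y hy => hy ▸ b_apply y)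

theorem isTranslationAt_cGen (hp : p ≠ zeroWord) (i : Fin 3) : IsTranslationAt (cGen i) p := by
  obtain ⟨n, hn⟩ := (eq_zeroWord_or_mem_W p).resolve_left hp
  have hW : ∀ᶠ y in 𝓝 p, y ∈ W n := (isOpen_W n).mem_nhds hn
  by_cases hpiece : (n : Fin 3) = 2 - i
  · exact (IsTranslationAt.one p).congr (hW.mono fun y hy => (cGen_apply hy).trans (if_pos hpiece))
  · have hc : IsTranslationAt c p := by
      refine .of_eventually_eq_add (t := Pi.single (n + 2) (p (n + 1))) ?_
      filter_upwards [hW, eventually_apply_eq p (n + 1)] with y hy hyn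
      exact hyn ▸ c_apply hy
    exact hc.congr (hW.mono fun y hy => (cGen_apply hy).trans (if_neg hpiece))

theorem isTranslationAt_of_mem_gens (hs : s ∈ gens) (p : Word) :
    IsTranslationAt s p ∨ p = zeroWord ∧ s ∈ H := by
  refine forall_mem_gens (P := fun s => IsTranslationAt s p ∨ p = zeroWord ∧ s ∈ H).2
    ⟨.inl (isTranslationAt_a p), .inl (isTranslationAt_b p), fun i => ?_⟩ s hs
  obtain rfl | hp := eq_or_ne p zeroWord
  · exact .inr ⟨rfl, cGen_mem_H i⟩
  · exact .inl (isTranslationAt_cGen hp i)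

theorem isTranslationAt_of_mem_gens_of_ne (hs : s ∈ gens) (hp : s p ≠ p) : IsTranslationAt s p :=
  (isTranslationAt_of_mem_gens hs p).resolve_right fun h => hp (h.1 ▸ H_apply_zeroWord h.2)

theorem exists_H_germ_mul (hs : s ∈ gens)
    (hg : ∃ h ∈ H, ∀ᶠ x in 𝓝 zeroWord, g x = h x + g zeroWord) :
    ∃ h ∈ H, ∀ᶠ x in 𝓝 zeroWord, (s * g) x = h x + (s * g) zeroWord := by
  obtain ⟨h, hh, hgerm⟩ := hg
  simp only [Homeomorph.mul_apply]
  obtain ht | ⟨h0, hsH⟩ := isTranslationAt_of_mem_gens hs (g zeroWord)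
  · refine ⟨h, hh, ?_⟩
    filter_upwards [hgerm, (g.continuous.tendsto zeroWord).eventually ht] with x hx hsx
    rw [hsx, hx]
    abel
  · refine ⟨s * h, H.mul_mem hsH hh, ?_⟩
    filter_upwards [hgerm] with x hx
    have hzero (y : Word) : y + zeroWord = y := add_zero y
    rw [hx, h0, H_apply_zeroWord hsH, hzero, hzero, Homeomorph.mul_apply]

theorem exists_H_germ (hg : g ∈ G) : ∃ h ∈ H, ∀ᶠ x in 𝓝 zeroWord, g x = h x + g zeroWord := by
  refine Subgroup.closure_induction_left
    (p := fun g _ => ∃ h ∈ H, ∀ᶠ x in 𝓝 zeroWord, g x = h x + g zeroWord)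
    ⟨1, H.one_mem, .of_forall fun x => (add_zero x).symm⟩
    (fun s hs g _ ih => exists_H_germ_mul hs ih) (fun s hs g _ ih => ?_) hg
  rw [inv_eq_self_of_mem_gens hs]
  exact exists_H_germ_mul hs ih

theorem existsUnique_H_germ (hg : g ∈ G) (h0 : g zeroWord = zeroWord) :
    ∃! h : Word ≃ₜ Word, h ∈ H ∧ ∀ᶠ x in 𝓝 zeroWord, g x = h x := by
  obtain ⟨h, hh, hgerm⟩ := exists_H_germ hg
  rw [h0] at hgerm
  have hgh : ∀ᶠ x in 𝓝 zeroWord, g x = h x := hgerm.mono fun x hx => hx.trans (add_zero _)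
  refine ⟨h, ⟨hh, hgh⟩, fun h' ⟨hh', hgh'⟩ => H_eq_of_eventuallyEq hh' hh ?_⟩
  filter_upwards [hgh, hgh'] with x hx hx'
  rw [← hx, hx']

theorem H_le_G : H ≤ G :=
  Subgroup.closure_mono ((Set.subset_insert _ _).trans (Set.subset_insert _ _))

theorem H_le_pointStab : H ≤ pointStab G zeroWord := fun _ hh => ⟨H_le_G hh, H_apply_zeroWord hh⟩

theorem nonempty_H_mulEquiv_germGroup : Nonempty (H ≃* GermGroup G zeroWord) :=
  germGroup_mulEquiv H_le_pointStab fun _ => existsUnique_H_germ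

theorem isSingular_zeroWord : IsSingular G zeroWord := by
  obtain ⟨e⟩ := nonempty_H_mulEquiv_germGroup
  have : Nontrivial H :=
    ⟨⟨cGen 0, cGen_mem_H 0⟩, 1, fun h => cGen_ne_one 0 (congrArg Subtype.val h)⟩
  exact e.symm.toEquiv.nontrivial

theorem isSingularOfGenerators_iff : IsSingularOfGenerators gens p ↔ p = zeroWord := by
  constructor
  · rintro ⟨s, hs, hsp, hne⟩
    exact ((isTranslationAt_of_mem_gens hs p).resolve_left
      fun ht => hne (ht.eventually_eq_self hsp)).1
  · rintro rfl
    exact ⟨cGen 0, cGen_mem_gens 0, cGen_zeroWord 0, not_eventually_cGen_eq_self 0⟩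

theorem isGermDefining_zeroWord : IsGermDefining gens zeroWord :=
  ⟨isSingular_zeroWord, fun _ _ => isSingularOfGenerators_iff, fun _ _ _ hl =>
    hl.eventually_prod_eq_self fun _ hs _ =>
      isTranslationAt_of_mem_gens_of_ne (mem_gens_of_mem_or_inv_mem hs)⟩

theorem exists_eqOn_piece_id (hh : h ∈ H) : ∃ j, Set.EqOn h id (piece j) := by
  obtain rfl | ⟨i, rfl⟩ := mem_H_iff.1 hh
  · exact ⟨0, Set.eqOn_refl _ _⟩
  · exact ⟨2 - i, cGen_eqOn_piece_same i⟩

theorem frequently_mem_piece (j : Fin 3) : ∃ᶠ x in 𝓝 zeroWord, x ∈ piece j := by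
  refine tendsto_testWord.frequently (frequently_atTop.2 fun N => ⟨3 * N + j, by lia, ?_⟩)
  exact Set.mem_iUnion.2 ⟨N, testWord_mem_W _⟩

theorem accPt_interior_fixedPoints (hg : g ∈ G) (h0 : g zeroWord = zeroWord) :
    AccPt zeroWord (𝓟 (interior {x | g x = x})) := by
  obtain ⟨h, ⟨hh, hgh⟩, -⟩ := existsUnique_H_germ hg h0
  obtain ⟨j, hj⟩ := exists_eqOn_piece_id hh
  refine accPt_iff_frequently.2 ?_
  refine ((frequently_mem_piece j).and_eventually (eventually_eventually_nhds.2 hgh)).mono ?_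
  rintro x ⟨hx, hgx⟩
  refine ⟨fun hx0 => zeroWord_notMem_piece (hx0 ▸ hx), mem_interior_iff_mem_nhds.2 ?_⟩
  filter_upwards [hgx, (isOpen_piece j).mem_nhds hx] with y hy hyj
  exact hy.trans (hj hyj)

theorem isPurelyNonHausdorff_iff (ζ : Word) : IsPurelyNonHausdorff gens ζ ↔ ζ = zeroWord := by
  constructor
  · rintro ⟨⟨-, hdef, -⟩, -⟩
    exact isSingularOfGenerators_iff.1 ((hdef 1 (one_mem _)).2 rfl)
  · rintro rfl
    exact ⟨isGermDefining_zeroWord, fun g => accPt_interior_fixedPoints⟩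

end Singularity

section Letters

/-- The letters of the formal words that represent the elements of `G`. -/
inductive Letter : Type
  | a : Letter
  | b : Letter
  | c : Fin 3 → Letter
  deriving DecidableEq, Fintype

namespace Letter

/-- The generator named by a letter. -/
noncomputable def gen : Letter → (Word ≃ₜ Word)
  | a => FragK110.a
  | b => FragK110.b
  | c i => cGen i

/-- The generator of `⟨a, b, c⟩` of which a letter is a fragment. -/
def kind : Letter → Fin 3
  | a => 0
  | b => 1
  | c _ => 2

/-- The permutation by which a letter acts on the last letter of a word. -/
def move : Letter → Fin 2 → Fin 2
  | a, p => p + 1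
  | b, p => p
  | c _, p => p

/-- The section of a letter at the last letter `p`, `none` if it is trivial. -/
def emit : Letter → Fin 2 → Option Letter
  | a, _ => none
  | b, p => if p = 0 then none else some a
  | c i, p => if p = 0 then some (c (i + 1)) else if i = 2 then none else some b

/-- The only place where a letter occurs as a section. -/
def home : Letter → Fin 2
  | a => 1
  | b => 1
  | c _ => 0

theorem move_add_one (l : Letter) (p : Fin 2) : l.move (p + 1) = l.move p + 1 := by
  cases l <;> rfl

theorem home_eq_of_emit_eq_some {l f : Letter} {p : Fin 2} (h : l.emit p = some f) :
    f.home = p := by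
  decide +revert

theorem move_eq_of_emit_eq_some {l f : Letter} {p : Fin 2} (h : l.emit p = some f) :
    l.move p = p := by
  decide +revert

theorem eq_or_exists_c_of_kind_eq {l x : Letter} (h : l.kind = x.kind) :
    l = x ∨ ∃ i j, i ≠ j ∧ l = c i ∧ x = c j := by
  decide +revert

theorem eq_a_or_eq_a_or_home_ne_of_kind_ne {x y : Letter} (h : x.kind ≠ y.kind) :
    x = a ∨ y = a ∨ x.home ≠ y.home := by
  decide +revert

end Letter

/-- The homeomorphism represented by a list of letters. As in a product of homeomorphisms, the last
letter of the list acts first. -/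
noncomputable def val (w : List Letter) : Word ≃ₜ Word := (w.map Letter.gen).prod

/-- The image of the last letter `p` under a list of letters. -/
def pos (p : Fin 2) (w : List Letter) : Fin 2 := w.foldr Letter.move p

/-- The section of a list of letters at the last letter `p`. -/
def sec (p : Fin 2) : List Letter → List Letter
  | [] => []
  | l :: w => (l.emit (pos p w)).toList ++ sec p w

/-- Neighbouring letters are fragments of different generators of `⟨a, b, c⟩`. -/
def Reduced (w : List Letter) : Prop := w.IsChain fun x y => x.kind ≠ y.kind

theorem val_cons (l : Letter) (w : List Letter) : val (l :: w) = l.gen * val w :=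
  List.prod_cons

theorem gen_mul_self (l : Letter) : l.gen * l.gen = 1 := by
  cases l
  exacts [a_mul_a, b_mul_b, cGen_mul_self _]

theorem gen_snoc (l : Letter) (v : Word) (p : Fin 2) :
    l.gen (snoc v p) = snoc (val (l.emit p).toList v) (l.move p) := by
  have hval (x : Letter) : val [x] = x.gen := List.prod_singleton
  cases l with
  | a => exact (wreath_a v p).trans (by fin_cases p <;> rfl)
  | b =>
    refine (wreath_b v p).trans ?_
    fin_cases p
    · rfl
    · exact congrArg (fun g : Word ≃ₜ Word => snoc (g v) 1) (hval .a).symm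
  | c i =>
    refine (wreath_cGen i v p).trans (congrArg (fun g : Word ≃ₜ Word => snoc (g v) p) ?_)
    fin_cases p
    · exact (hval (.c (i + 1))).symm
    · by_cases hi : i = 2
      · simp [Letter.emit, hi, val]
      · simp [Letter.emit, hi, hval, Letter.gen]

theorem val_snoc (w : List Letter) (v : Word) (p : Fin 2) :
    val w (snoc v p) = snoc (val (sec p w) v) (pos p w) := by
  induction w with
  | nil => rfl
  | cons l w ih =>
    rw [val_cons, Homeomorph.mul_apply, ih, gen_snoc]
    simp only [sec, val, List.map_append, List.prod_append, Homeomorph.mul_apply]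
    rfl

theorem pos_one (w : List Letter) : pos 1 w = pos 0 w + 1 := by
  induction w with
  | nil => rfl
  | cons l w ih => exact (congrArg l.move ih).trans (l.move_add_one _)

theorem exists_val_eq {g : Word ≃ₜ Word} (hg : g ∈ G) :
    ∃ w : List Letter, val w = g ∧ w.length = wordLength gens g := by
  obtain ⟨l, hl, rfl, hlen⟩ := exists_word gens hg
  have hletter : ∀ s ∈ gens, ∃ x : Letter, x.gen = s :=
    forall_mem_gens.2 ⟨⟨.a, rfl⟩, ⟨.b, rfl⟩, fun i => ⟨.c i, rfl⟩⟩
  have hrange : l ∈ Set.range (List.map Letter.gen) := by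
    rw [Set.range_list_map]
    exact fun s hs => hletter s (mem_gens_of_mem_or_inv_mem (hl s hs))
  obtain ⟨w, rfl⟩ := hrange
  exact ⟨w, rfl, by rw [← hlen, List.length_map]⟩

end Letters

section Weights

variable {η : ℝ}

/-- The price of having sections at the places `p` and `q` of the wreath recursion next to each
other. -/
def toll (p q : Fin 2) : ℝ := if p = q then 0 else 2

namespace Letter

/-- The base price of a letter. The values solve `η * base b = base a`,
`η * (base (c i) + 2) = base (c (i + 1)) + base b` for `i = 0, 1` and
`η * (base (c 2) + 2) = base (c 0)`, which say that the sections of `b` and of `c i` cost `η` times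
as much as `b`, and as `c i` with a toll, do. -/
def base (η : ℝ) : Letter → ℝ
  | a => η ^ 2 + η ^ 3 + η ^ 4
  | b => η + η ^ 2 + η ^ 3
  | c i => ![2 * η + η ^ 2, η + η ^ 2, η] i

/-- The weight of a pair of neighbouring letters. -/
def gap (η : ℝ) (x y : Letter) : ℝ := x.base η + y.base η + toll x.home y.home

/-- The base price of the section of a letter at `p`. For `a`, which has no sections but moves
between the two places, it is half the toll of that move. -/
def share (η : ℝ) (p : Fin 2) : Letter → ℝ
  | a => 1
  | l => (l.emit p).elim 0 (base η)

end Letter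

/-- The weight of a list of letters. -/
def weight (η : ℝ) : List Letter → ℝ
  | x :: y :: w => x.gap η y + weight η (y :: w)
  | _ => 0

/-- A bound for the weight of `sec p w`, as a sum over the pairs of neighbouring letters
of `w`. -/
def budget (η : ℝ) (p : Fin 2) : List Letter → ℝ
  | x :: y :: w =>
    x.share η (pos p (y :: w)) + y.share η (pos p (y :: w)) + budget η p (y :: w)
  | _ => 0

/-- What a letter emitted at the place `q` adds to the weight of a list, apart from its own base
price. -/
def reserve (η : ℝ) (q : Fin 2) : List Letter → ℝ
  | x :: _ => x.base η + toll x.home q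
  | [] => 0

theorem toll_self (p : Fin 2) : toll p p = 0 := if_pos rfl

theorem toll_comm (p q : Fin 2) : toll p q = toll q p := if_congr eq_comm rfl rfl

theorem toll_nonneg (p q : Fin 2) : 0 ≤ toll p q := by
  unfold toll; split_ifs <;> norm_num

theorem toll_le_two (p q : Fin 2) : toll p q ≤ 2 := by
  unfold toll; split_ifs <;> norm_num

theorem toll_triangle (p q r : Fin 2) : toll p r ≤ toll p q + toll q r := by
  unfold toll; split_ifs <;> grind

namespace Letter

theorem base_nonneg (h0 : 0 ≤ η) (x : Letter) : 0 ≤ x.base η := by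
  rcases x with _ | _ | i
  · simp only [base]; positivity
  · simp only [base]; positivity
  · fin_cases i
    · change 0 ≤ 2 * η + η ^ 2
      positivity
    · change 0 ≤ η + η ^ 2
      positivity
    · exact h0

theorem base_le_three (h0 : 0 ≤ η) (h1 : η ≤ 1) (x : Letter) : x.base η ≤ 3 := by
  have hpow (n : ℕ) : η ^ n ≤ 1 := pow_le_one₀ h0 h1
  rcases x with _ | _ | i
  · simp only [base]; linarith [hpow 2, hpow 3, hpow 4]
  · simp only [base]; linarith [hpow 2, hpow 3]
  · fin_cases i <;> simp [base] <;> linarith [hpow 2]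

theorem base_c_neg_add_le (h0 : 0 ≤ η) {i j : Fin 3} (hij : i ≠ j) :
    (c (-(i + j))).base η ≤ (c i).base η + (c j).base η := by
  have h2 : 0 ≤ η ^ 2 := sq_nonneg η
  fin_cases i <;> fin_cases j <;> first | exact absurd rfl hij | (simp [base]; linarith)

theorem gap_nonneg (h0 : 0 ≤ η) (x y : Letter) : 0 ≤ x.gap η y :=
  add_nonneg (add_nonneg (base_nonneg h0 x) (base_nonneg h0 y)) (toll_nonneg _ _)

theorem gap_triangle (h0 : 0 ≤ η) (x y z : Letter) : x.gap η z ≤ x.gap η y + y.gap η z := by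
  unfold gap
  linarith [base_nonneg h0 y, toll_triangle x.home y.home z.home]

theorem two_le_base_a (h0 : 0 ≤ η) (h1 : η ≤ 1) (hη : 2 ≤ η ^ 5 + η ^ 4 + η ^ 3) :
    2 ≤ a.base η := by
  have h52 : η ^ 5 ≤ η ^ 2 := pow_le_pow_of_le_one h0 h1 (by norm_num)
  change 2 ≤ η ^ 2 + η ^ 3 + η ^ 4
  linarith

theorem two_le_gap (h0 : 0 ≤ η) (h1 : η ≤ 1) (hη : 2 ≤ η ^ 5 + η ^ 4 + η ^ 3) {x y : Letter}
    (hxy : x.kind ≠ y.kind) : 2 ≤ x.gap η y := by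
  have hx := base_nonneg h0 x
  have hy := base_nonneg h0 y
  have htoll := toll_nonneg x.home y.home
  have ha := two_le_base_a h0 h1 hη
  unfold gap
  obtain rfl | rfl | hhome := eq_a_or_eq_a_or_home_ne_of_kind_ne hxy
  · linarith
  · linarith
  · rw [toll, if_neg hhome]
    linarith

theorem gap_le_eight (h0 : 0 ≤ η) (h1 : η ≤ 1) (x y : Letter) : x.gap η y ≤ 8 := by
  unfold gap
  linarith [base_le_three h0 h1 x, base_le_three h0 h1 y, toll_le_two x.home y.home]

theorem share_of_emit_eq_some {l f : Letter} {p : Fin 2} (h : l.emit p = some f) :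
    l.share η p = f.base η := by
  cases l
  · simp [emit] at h
  all_goals exact congrArg (Option.elim · 0 (base η)) h

theorem share_nonneg (h0 : 0 ≤ η) (p : Fin 2) (l : Letter) : 0 ≤ l.share η p := by
  cases he : l.emit p with
  | some f => exact share_of_emit_eq_some he ▸ base_nonneg h0 f
  | none => cases l <;> simp [share, he]

theorem toll_move_le_share (h0 : 0 ≤ η) (p : Fin 2) (l : Letter) :
    toll p (l.move p) ≤ l.share η p + l.share η (l.move p) := by
  cases l with
  | a => exact (toll_le_two _ _).trans_eq one_add_one_eq_two.symm
  | b | c i => exact (toll_self p).trans_le (add_nonneg (share_nonneg h0 _ _) (share_nonneg h0 _ _))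

theorem share_zero_add_share_one_c (i : Fin 3) :
    (c i).share η 0 + (c i).share η 1 = η * ((c i).base η + 2) := by
  fin_cases i <;> simp [share, emit, base] <;> ring

theorem sum_share_le_mul_gap (h0 : 0 ≤ η) (hη : 2 ≤ η ^ 5 + η ^ 4 + η ^ 3) {x y : Letter}
    (hxy : x.kind ≠ y.kind) :
    (x.share η 0 + x.share η 1) + (y.share η 0 + y.share η 1) ≤ η * x.gap η y := by
  have ha : a.share η 0 + a.share η 1 ≤ η * a.base η := by
    simp only [share, base]
    linarith
  have hb : b.share η 0 + b.share η 1 = η * b.base η := by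
    simp [share, emit, base]
    ring
  have htoll := mul_nonneg h0 (toll_nonneg x.home y.home)
  unfold gap
  rcases x with _ | _ | i <;> rcases y with _ | _ | j <;> first | exact absurd rfl hxy | skip
  all_goals
    simp only [home, toll, share_zero_add_share_one_c] at htoll ⊢
    simp only [Fin.isValue, one_ne_zero, zero_ne_one, reduceIte]
    linarith

end Letter

theorem weight_nonneg (h0 : 0 ≤ η) : ∀ w : List Letter, 0 ≤ weight η w
  | [] => le_rfl
  | [_] => le_rfl
  | x :: y :: w => add_nonneg (x.gap_nonneg h0 y) (weight_nonneg h0 (y :: w))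

theorem weight_le_eight_mul_length (h0 : 0 ≤ η) (h1 : η ≤ 1) :
    ∀ w : List Letter, weight η w ≤ 8 * w.length
  | [] => by simp [weight]
  | [_] => by simp [weight]
  | x :: y :: w => by
    have ih := weight_le_eight_mul_length h0 h1 (y :: w)
    have hgap := x.gap_le_eight h0 h1 y
    rw [List.length_cons, Nat.cast_succ, weight]
    linarith

theorem weight_le_weight_cons (h0 : 0 ≤ η) (x : Letter) (w : List Letter) :
    weight η w ≤ weight η (x :: w) := by
  cases w with
  | nil => exact le_rfl
  | cons y w => exact le_add_of_nonneg_left (x.gap_nonneg h0 y)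

theorem weight_cons_le_weight_cons_cons (h0 : 0 ≤ η) (z x : Letter) (w : List Letter) :
    weight η (z :: w) ≤ weight η (z :: x :: w) := by
  cases w with
  | nil => exact weight_nonneg h0 [z, x]
  | cons y w =>
    simp only [weight]
    linarith [Letter.gap_triangle h0 z x y]

theorem reserve_nonneg (h0 : 0 ≤ η) (q : Fin 2) : ∀ w, 0 ≤ reserve η q w
  | [] => le_rfl
  | x :: _ => add_nonneg (x.base_nonneg h0) (toll_nonneg _ _)

theorem reserve_le_add_toll (p q : Fin 2) : ∀ w, reserve η q w ≤ reserve η p w + toll p q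
  | [] => (toll_nonneg p q).trans_eq (zero_add _).symm
  | x :: _ => by
    simp only [reserve]
    linarith [toll_triangle x.home p q]

theorem weight_cons_le_add_reserve (h0 : 0 ≤ η) (f : Letter) :
    ∀ w, weight η (f :: w) ≤ weight η w + reserve η f.home w + f.base η
  | [] => by simpa [weight, reserve] using f.base_nonneg h0
  | x :: w => by
    simp only [weight, reserve, Letter.gap]
    linarith [toll_comm f.home x.home]

theorem weight_sec_cons_le (h0 : 0 ≤ η) (p : Fin 2) (l : Letter) (w : List Letter) :
    weight η (sec p (l :: w)) ≤
      weight η (sec p w) + reserve η (pos p w) (sec p w) + l.share η (pos p w) := by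
  rw [sec]
  cases he : l.emit (pos p w) with
  | none =>
    have hreserve := reserve_nonneg h0 (pos p w) (sec p w)
    have hshare := l.share_nonneg h0 (pos p w)
    rw [Option.toList_none, List.nil_append]
    linarith
  | some f =>
    rw [Letter.share_of_emit_eq_some he, ← Letter.home_eq_of_emit_eq_some he]
    exact weight_cons_le_add_reserve h0 f (sec p w)

theorem weight_add_reserve_sec_cons_le (h0 : 0 ≤ η) (p : Fin 2) (l : Letter) (w : List Letter) :
    weight η (sec p (l :: w)) + reserve η (pos p (l :: w)) (sec p (l :: w)) ≤
      weight η (sec p w) + reserve η (pos p w) (sec p w) + l.share η (pos p w) +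
        l.share η (pos p (l :: w)) := by
  change _ + reserve η (l.move (pos p w)) _ ≤ _ + l.share η (l.move (pos p w))
  cases he : l.emit (pos p w) with
  | none =>
    rw [sec, he, Option.toList_none, List.nil_append]
    linarith [l.toll_move_le_share h0 (pos p w),
      reserve_le_add_toll (η := η) (pos p w) (l.move (pos p w)) (sec p w)]
  | some f =>
    have hreserve : reserve η (pos p w) (sec p (l :: w)) = l.share η (pos p w) := by
      rw [sec, he, Letter.share_of_emit_eq_some he, ← Letter.home_eq_of_emit_eq_some he]
      exact (congrArg _ (toll_self _)).trans (add_zero _)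
    rw [Letter.move_eq_of_emit_eq_some he, hreserve]
    exact add_le_add_left (weight_sec_cons_le h0 p l w) _

theorem weight_add_reserve_sec_le (h0 : 0 ≤ η) (p : Fin 2) :
    ∀ (w : List Letter) (l : Letter),
      weight η (sec p (l :: w)) + reserve η (pos p (l :: w)) (sec p (l :: w)) ≤
        budget η p (l :: w) + l.share η (pos p (l :: w))
  | [], l => by
    change _ ≤ 0 + l.share η (l.move p)
    cases he : l.emit p with
    | none => simpa [sec, pos, he, weight, reserve] using l.share_nonneg h0 (l.move p)
    | some f =>
      simp [sec, pos, he, weight, reserve, Letter.move_eq_of_emit_eq_some he,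
        Letter.home_eq_of_emit_eq_some he, Letter.share_of_emit_eq_some he, toll_self]
  | x :: w, l => by
    rw [budget]
    linarith [weight_add_reserve_sec_le h0 p w x, weight_add_reserve_sec_cons_le h0 p l (x :: w)]

theorem weight_sec_le_budget (h0 : 0 ≤ η) (p : Fin 2) :
    ∀ w : List Letter, weight η (sec p w) ≤ budget η p w
  | [] => le_rfl
  | [l] => by cases he : l.emit p <;> simp [sec, pos, he, weight, budget]
  | l :: x :: w => by
    rw [budget]
    linarith [weight_sec_cons_le h0 p l (x :: w), weight_add_reserve_sec_le h0 p w x]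

theorem budget_zero_add_budget_one_le (h0 : 0 ≤ η) (hη : 2 ≤ η ^ 5 + η ^ 4 + η ^ 3) :
    ∀ {w : List Letter}, Reduced w → budget η 0 w + budget η 1 w ≤ η * weight η w
  | [], _ => by simp [budget, weight]
  | [_], _ => by simp [budget, weight]
  | x :: y :: w, hw => by
    obtain ⟨hxy, hw⟩ := List.isChain_cons_cons.1 hw
    have hplaces (l : Letter) : l.share η (pos 0 (y :: w)) + l.share η (pos 1 (y :: w)) =
        l.share η 0 + l.share η 1 := by
      rw [pos_one]
      obtain h | h : pos 0 (y :: w) = 0 ∨ pos 0 (y :: w) = 1 := by grind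
      · rw [h, zero_add]
      · rw [h]
        exact add_comm _ _
    have ih := budget_zero_add_budget_one_le h0 hη hw
    have hgap := Letter.sum_share_le_mul_gap h0 hη hxy
    simp only [budget, weight, mul_add]
    linarith [hplaces x, hplaces y]

theorem weight_sec_zero_add_weight_sec_one_le (h0 : 0 ≤ η) (hη : 2 ≤ η ^ 5 + η ^ 4 + η ^ 3)
    {w : List Letter} (hw : Reduced w) :
    weight η (sec 0 w) + weight η (sec 1 w) ≤ η * weight η w :=
  (add_le_add (weight_sec_le_budget h0 0 w) (weight_sec_le_budget h0 1 w)).trans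
    (budget_zero_add_budget_one_le h0 hη hw)

theorem Reduced.length_le_one (h0 : 0 ≤ η) (h1 : η ≤ 1) (hη : 2 ≤ η ^ 5 + η ^ 4 + η ^ 3) :
    ∀ {w : List Letter}, Reduced w → weight η w < 2 → w.length ≤ 1
  | [], _, _ => zero_le_one
  | [_], _, _ => le_rfl
  | x :: y :: w, hw, hlt => by
    have hgap := Letter.two_le_gap h0 h1 hη (List.isChain_cons_cons.1 hw).1
    have htail := weight_nonneg h0 (y :: w)
    rw [weight] at hlt
    linarith

end Weights

section Reduction

variable {η : ℝ}

/-- `v` weighs at most as much as `w`, alone and after any letter. -/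
def Lighter (η : ℝ) (v w : List Letter) : Prop :=
  weight η v ≤ weight η w ∧ ∀ z, weight η (z :: v) ≤ weight η (z :: w)

theorem Lighter.refl (w : List Letter) : Lighter η w w := ⟨le_rfl, fun _ => le_rfl⟩

theorem Lighter.trans {u v w : List Letter} (huv : Lighter η u v) (hvw : Lighter η v w) :
    Lighter η u w :=
  ⟨huv.1.trans hvw.1, fun z => (huv.2 z).trans (hvw.2 z)⟩

theorem Lighter.cons {v w : List Letter} (h : Lighter η v w) (x : Letter) :
    Lighter η (x :: v) (x :: w) :=
  ⟨h.2 x, fun z => add_le_add_right (h.2 x) (z.gap η x)⟩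

theorem lighter_cons (h0 : 0 ≤ η) (x : Letter) (w : List Letter) : Lighter η w (x :: w) :=
  ⟨weight_le_weight_cons h0 x w, fun z => weight_cons_le_weight_cons_cons h0 z x w⟩

theorem weight_c_neg_add_cons_le (h0 : 0 ≤ η) {i j : Fin 3} (hij : i ≠ j) (w : List Letter) :
    weight η (.c (-(i + j)) :: w) + (Letter.c j).base η ≤ weight η (.c i :: .c j :: w) := by
  have hi := (Letter.c i).base_nonneg h0
  have hmerge := Letter.base_c_neg_add_le h0 hij
  cases w with
  | nil =>
    simp only [weight, Letter.gap]
    linarith [toll_nonneg (Letter.c i).home (Letter.c j).home]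
  | cons y w =>
    simp only [weight, Letter.gap, Letter.home, toll_self]
    linarith

theorem lighter_c_neg_add_cons (h0 : 0 ≤ η) {i j : Fin 3} (hij : i ≠ j) (w : List Letter) :
    Lighter η (.c (-(i + j)) :: w) (.c i :: .c j :: w) := by
  have hw := weight_c_neg_add_cons_le h0 hij w
  refine ⟨(le_add_of_nonneg_right ((Letter.c j).base_nonneg h0)).trans hw, fun z => ?_⟩
  have hmerge := Letter.base_c_neg_add_le h0 hij
  rw [weight, weight]
  simp only [Letter.gap, Letter.home]
  linarith

theorem exists_reduced_cons (h0 : 0 ≤ η) (l : Letter) {w : List Letter} (hw : Reduced w) :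
    ∃ w', Reduced w' ∧ val w' = val (l :: w) ∧ Lighter η w' (l :: w) := by
  cases w with
  | nil => exact ⟨[l], .singleton l, rfl, .refl _⟩
  | cons x w =>
    by_cases hkind : l.kind = x.kind
    · obtain rfl | ⟨i, j, hij, rfl, rfl⟩ := Letter.eq_or_exists_c_of_kind_eq hkind
      · refine ⟨w, hw.tail, ?_, (lighter_cons h0 l w).trans (lighter_cons h0 l _)⟩
        rw [val_cons, val_cons, ← mul_assoc, gen_mul_self, one_mul]
      · refine ⟨.c (-(i + j)) :: w, ?_, ?_, lighter_c_neg_add_cons h0 hij w⟩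
        · cases w with
          | nil => exact .singleton _
          | cons y w => exact List.isChain_cons_cons.2 (List.isChain_cons_cons.1 hw)
        · simp only [val_cons, Letter.gen, ← mul_assoc, cGen_mul_cGen hij]
    · exact ⟨l :: x :: w, List.isChain_cons_cons.2 ⟨hkind, hw⟩, rfl, .refl _⟩

theorem exists_reduced (h0 : 0 ≤ η) (w : List Letter) :
    ∃ w', Reduced w' ∧ val w' = val w ∧ Lighter η w' w := by
  induction w with
  | nil => exact ⟨[], .nil, rfl, .refl _⟩
  | cons l w ih =>
    obtain ⟨v, hv, hval, hlight⟩ := ih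
    obtain ⟨u, hu, huval, hulight⟩ := exists_reduced_cons h0 l hv
    exact ⟨u, hu, by rw [huval, val_cons, val_cons, hval], hulight.trans (hlight.cons l)⟩

end Reduction

section Portraits

variable {A P X : Type*}

/-- A finite binary tree with leaves labelled by `A` and inner nodes labelled by `P`. It describes
an element of a self-similar group by repeated use of the wreath recursion. -/
inductive Portrait (A P : Type*)
  | leaf (x : A)
  | node (p : P) (s t : Portrait A P)

namespace Portrait

/-- The number of inner nodes. -/
def size : Portrait A P → ℕ
  | leaf _ => 0
  | node _ s t => s.size + t.size + 1

/-- The labels in preorder, which determine the tree. -/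
def encode : Portrait A P → List (A ⊕ P)
  | leaf x => [.inl x]
  | node p s t => .inr p :: (s.encode ++ t.encode)

/-- The element described by a portrait, where `f x` is the value of a leaf and `g p` combines the
values of the two branches at an inner node. -/
def eval (f : A → X) (g : P → X → X → X) : Portrait A P → X
  | leaf x => f x
  | node p s t => g p (s.eval f g) (t.eval f g)

theorem length_encode : ∀ t : Portrait A P, t.encode.length = 2 * t.size + 1
  | leaf _ => rfl
  | node _ s t => by
    simp only [encode, size, List.length_cons, List.length_append, length_encode s,
      length_encode t]
    lia

theorem eq_and_eq_of_encode_append_eq :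
    ∀ {s t : Portrait A P} {l m : List (A ⊕ P)}, s.encode ++ l = t.encode ++ m → s = t ∧ l = m
  | leaf _, leaf _, _, _, h => by simpa [encode] using h
  | leaf _, node .., _, _, h => by simp [encode] at h
  | node .., leaf _, _, _, h => by simp [encode] at h
  | node p s₁ s₂, node q t₁ t₂, l, m, h => by
    simp only [encode, List.cons_append, List.append_assoc, List.cons.injEq, Sum.inr.injEq] at h
    obtain ⟨rfl, h⟩ := h
    obtain ⟨rfl, h₂⟩ := eq_and_eq_of_encode_append_eq h
    obtain ⟨rfl, rfl⟩ := eq_and_eq_of_encode_append_eq h₂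
    exact ⟨rfl, rfl⟩

theorem encode_injective : Function.Injective (encode : Portrait A P → List (A ⊕ P)) :=
  fun _ _ h => (eq_and_eq_of_encode_append_eq (congrArg (· ++ []) h)).1

end Portrait

theorem ncard_setOf_length_le_le (α : Type*) [Finite α] (n : ℕ) :
    {l : List α | l.length ≤ n}.ncard ≤ (Nat.card α + 1) ^ n := by
  have hinj : Set.InjOn (fun (l : List α) (i : Fin n) => l[(i : ℕ)]?) {l | l.length ≤ n} := by
    intro l (hl : l.length ≤ n) m (hm : m.length ≤ n) h
    refine List.ext_getElem? fun k => ?_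
    obtain hk | hk := lt_or_ge k n
    · exact congrFun h ⟨k, hk⟩
    · rw [List.getElem?_eq_none (hl.trans hk), List.getElem?_eq_none (hm.trans hk)]
  calc {l : List α | l.length ≤ n}.ncard
      ≤ (Set.univ : Set (Fin n → Option α)).ncard :=
        Set.ncard_le_ncard_of_injOn _ (fun _ _ => Set.mem_univ _) hinj
    _ = (Nat.card α + 1) ^ n := by
        rw [Set.ncard_univ, Nat.card_fun, Nat.card_fin, Finite.card_option]

theorem ncard_le_of_forall_exists_portrait [Finite A] [Finite P] {f : A → X}
    {g : P → X → X → X} {S : Set X} {n : ℕ}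
    (hS : ∀ x ∈ S, ∃ t : Portrait A P, t.eval f g = x ∧ t.size ≤ n) :
    S.ncard ≤ (Nat.card A + Nat.card P + 1) ^ (2 * n + 1) := by
  let T : Set (Portrait A P) := {t | t.size ≤ n}
  have hlength : Set.MapsTo Portrait.encode T {l | l.length ≤ 2 * n + 1} := by
    intro t (ht : t.size ≤ n)
    change t.encode.length ≤ 2 * n + 1
    rw [t.length_encode]
    lia
  have hwords := List.finite_length_le (A ⊕ P) (2 * n + 1)
  have hT : T.Finite := .of_injOn hlength Portrait.encode_injective.injOn hwords
  calc S.ncard ≤ (Portrait.eval f g '' T).ncard :=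
        Set.ncard_le_ncard (fun x hx => have ⟨t, ht, hn⟩ := hS x hx; ⟨t, hn, ht⟩) (hT.image _)
    _ ≤ T.ncard := Set.ncard_image_le hT
    _ ≤ {l : List (A ⊕ P) | l.length ≤ 2 * n + 1}.ncard :=
        Set.ncard_le_ncard_of_injOn _ hlength Portrait.encode_injective.injOn hwords
    _ ≤ (Nat.card A + Nat.card P + 1) ^ (2 * n + 1) :=
        Nat.card_sum (α := A) (β := P) ▸ ncard_setOf_length_le_le (A ⊕ P) (2 * n + 1)

end Portraits

section Contraction

variable {Ω A P X : Type*} {f : A → X} {g : P → X → X → X} {val : Ω → X} {L : Ω → ℝ}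
  {η τ α : ℝ}

/-- Every element of `X` represented by some `w : Ω` is either the value of a leaf or combined out
of two elements with representatives of total weight at most `η * L w`. The first case holds below
the threshold `τ`. -/
structure IsContracting (f : A → X) (g : P → X → X → X) (val : Ω → X) (L : Ω → ℝ) (η τ : ℝ) :
    Prop where
  nonneg (w : Ω) : 0 ≤ L w
  leaf_or_node (w : Ω) : val w ∈ Set.range f ∨
    τ ≤ L w ∧ ∃ p u v, g p (val u) (val v) = val w ∧ L u + L v ≤ η * L w

theorem rpow_add_rpow_le_two_mul_rpow {x y : ℝ} (hx : 0 ≤ x) (hy : 0 ≤ y) (hα0 : 0 ≤ α)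
    (hα1 : α ≤ 1) : x ^ α + y ^ α ≤ 2 * ((x + y) / 2) ^ α := by
  have hconcave := (Real.concaveOn_rpow hα0 hα1).2 (Set.mem_Ici.2 hx) (Set.mem_Ici.2 hy)
    one_half_pos.le one_half_pos.le (add_halves 1)
  simp only [smul_eq_mul] at hconcave
  rw [show (x + y) / 2 = 1 / 2 * x + 1 / 2 * y by ring]
  linarith

theorem rpow_add_rpow_le_of_add_le {x y z : ℝ} (hx : 0 ≤ x) (hy : 0 ≤ y) (hz : 0 ≤ z)
    (hη : 0 ≤ η) (hα0 : 0 ≤ α) (hα1 : α ≤ 1) (hxy : x + y ≤ η * z) :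
    x ^ α + y ^ α ≤ 2 * (η / 2) ^ α * z ^ α :=
  calc x ^ α + y ^ α ≤ 2 * ((x + y) / 2) ^ α := rpow_add_rpow_le_two_mul_rpow hx hy hα0 hα1
    _ ≤ 2 * (η / 2 * z) ^ α := by gcongr; linarith
    _ = 2 * (η / 2) ^ α * z ^ α := by rw [Real.mul_rpow (by positivity) hz, mul_assoc]

/-- The factor `K` of `L w ^ α` solves `K * (2 * (η / 2) ^ α) * τ ^ α + 1 = K * τ ^ α`, so that
`K * x ^ α` pays for a node whenever `τ ≤ x`. -/
theorem IsContracting.exists_portrait (h : IsContracting f g val L η τ) (hτ : 0 < τ)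
    (hη0 : 0 < η) (hη1 : η < 1) (hα0 : 0 ≤ α) (hα1 : α ≤ 1) (hα : 2 * (η / 2) ^ α < 1) (w : Ω) :
    ∃ t : Portrait A P, t.eval f g = val w ∧
      t.size ≤ ((1 - 2 * (η / 2) ^ α) * τ ^ α)⁻¹ * L w ^ α := by
  set θ := 2 * (η / 2) ^ α
  set K := ((1 - θ) * τ ^ α)⁻¹
  have hθτ : 0 < (1 - θ) * τ ^ α := mul_pos (sub_pos.2 hα) (Real.rpow_pos_of_pos hτ α)
  have hK : 0 ≤ K := (inv_pos.2 hθτ).le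
  have hL0 (z : Ω) : 0 ≤ L z ^ α := Real.rpow_nonneg (h.nonneg z) α
  obtain ⟨m, hm⟩ := pow_unbounded_of_one_lt (L w / τ) ((one_lt_inv₀ hη0).2 hη1)
  induction m generalizing w with
  | zero =>
    obtain ⟨x, hx⟩ := (h.leaf_or_node w).resolve_right fun hw =>
      hw.1.not_gt ((div_lt_one hτ).1 hm)
    exact ⟨.leaf x, hx, Nat.cast_zero.trans_le (mul_nonneg hK (hL0 w))⟩
  | succ m ih =>
    obtain ⟨x, hx⟩ | ⟨hτw, p, u, v, huv, hL⟩ := h.leaf_or_node w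
    · exact ⟨.leaf x, hx, Nat.cast_zero.trans_le (mul_nonneg hK (hL0 w))⟩
    have hstep (z : Ω) (hz : L z ≤ η * L w) : L z / τ < η⁻¹ ^ m := by
      rw [pow_succ, ← div_eq_mul_inv, lt_div_iff₀ hη0, div_mul_eq_mul_div, mul_comm] at hm
      exact (div_le_div_of_nonneg_right hz hτ.le).trans_lt hm
    obtain ⟨s, hs, hssize⟩ := ih u (hstep u (by linarith [h.nonneg v]))
    obtain ⟨t, ht, htsize⟩ := ih v (hstep v (by linarith [h.nonneg u]))
    refine ⟨.node p s t, by rw [Portrait.eval, hs, ht, huv], ?_⟩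
    have hone : 1 ≤ K * ((1 - θ) * L w ^ α) :=
      calc 1 = K * ((1 - θ) * τ ^ α) := (inv_mul_cancel₀ hθτ.ne').symm
        _ ≤ K * ((1 - θ) * L w ^ α) := by gcongr
    have hsum : L u ^ α + L v ^ α ≤ θ * L w ^ α :=
      rpow_add_rpow_le_of_add_le (h.nonneg u) (h.nonneg v) (h.nonneg w) hη0.le hα0 hα1 hL
    calc ((Portrait.node p s t).size : ℝ) = s.size + t.size + 1 := by
          rw [Portrait.size, Nat.cast_succ, Nat.cast_add]
      _ ≤ K * (L u ^ α + L v ^ α) + K * ((1 - θ) * L w ^ α) := by linarith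
      _ ≤ K * (θ * L w ^ α) + K * ((1 - θ) * L w ^ α) := by gcongr
      _ = K * L w ^ α := by ring

theorem dominated_exp_rpow_of_le {F : ℝ → ℝ} {D : ℝ} (hα : 0 < α)
    (hF : ∀ R, 1 ≤ R → F R ≤ Real.exp (D * R ^ α)) : Dominated F fun R => Real.exp (R ^ α) := by
  set C := max 1 (max D 0 ^ α⁻¹)
  have hC : 1 ≤ C := le_max_left _ _
  refine ⟨C, hC, fun R hR => (hF R hR).trans (Real.exp_le_exp.2 ?_)⟩
  have hD : D ≤ C ^ α :=
    calc D ≤ max D 0 := le_max_left _ _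
      _ = (max D 0 ^ α⁻¹) ^ α := (Real.rpow_inv_rpow (le_max_right _ _) hα.ne').symm
      _ ≤ C ^ α := by gcongr; exact le_max_right _ _
  rw [Real.mul_rpow (by linarith) (by linarith)]
  gcongr

theorem Dominated.exp_rpow_mono {F : ℝ → ℝ} {β : ℝ} (hαβ : α ≤ β)
    (h : Dominated F fun R => Real.exp (R ^ α)) : Dominated F fun R => Real.exp (R ^ β) := by
  obtain ⟨C, hC, hF⟩ := h
  refine ⟨C, hC, fun R hR => (hF R hR).trans (Real.exp_le_exp.2 ?_)⟩
  exact Real.rpow_le_rpow_of_exponent_le (one_le_mul_of_one_le_of_one_le hC hR) hαβ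

theorem two_mul_div_two_rpow_lt_one (hη0 : 0 < η) (hη1 : η < 1)
    (hα : Real.log 2 / (Real.log 2 - Real.log η) < α) : 2 * (η / 2) ^ α < 1 := by
  have hlogη := Real.log_neg hη0 hη1
  have hlog2 := Real.log_pos one_lt_two
  have hmul := (div_lt_iff₀ (by linarith)).1 hα
  rw [← Real.log_neg_iff (by positivity), Real.log_mul two_ne_zero (by positivity),
    Real.log_rpow (by positivity), Real.log_div hη0.ne' two_ne_zero]
  linarith

theorem IsContracting.growth_le [Finite A] [Finite P] {Γ : Type*} [Group Γ] {S : Set Γ}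
    {φ : Γ → X} {C : ℝ} (h : IsContracting f g val L η τ) (hφ : Function.Injective φ) (hC : 0 ≤ C)
    (hval : ∀ γ ∈ Subgroup.closure S, ∃ w, val w = φ γ ∧ L w ≤ C * wordLength S γ)
    (hτ : 0 < τ) (hη0 : 0 < η) (hη1 : η < 1) (hα0 : 0 ≤ α) (hα1 : α ≤ 1)
    (hα : 2 * (η / 2) ^ α < 1) (R : ℝ) :
    growth S R ≤ (Nat.card A + Nat.card P + 1) ^
      (2 * ⌊((1 - 2 * (η / 2) ^ α) * τ ^ α)⁻¹ * (C * R) ^ α⌋₊ + 1) := by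
  have hK : 0 ≤ ((1 - 2 * (η / 2) ^ α) * τ ^ α)⁻¹ :=
    inv_nonneg.2 (mul_nonneg (sub_pos.2 hα).le (Real.rpow_nonneg hτ.le α))
  rw [growth, ← Set.ncard_image_of_injective _ hφ]
  refine ncard_le_of_forall_exists_portrait (f := f) (g := g) ?_
  rintro _ ⟨γ, ⟨hγ, hlength⟩, rfl⟩
  obtain ⟨w, hw, hLw⟩ := hval γ hγ
  obtain ⟨t, ht, hsize⟩ := h.exists_portrait hτ hη0 hη1 hα0 hα1 hα w
  refine ⟨t, ht.trans hw, Nat.le_floor (hsize.trans ?_)⟩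
  have hLR : L w ≤ C * R := hLw.trans (mul_le_mul_of_nonneg_left hlength hC)
  exact mul_le_mul_of_nonneg_left (Real.rpow_le_rpow (h.nonneg w) hLR hα0) hK

theorem IsContracting.growth_dominated_of_le_one [Finite A] [Finite P] {Γ : Type*} [Group Γ]
    {S : Set Γ} {φ : Γ → X} {C : ℝ} (h : IsContracting f g val L η τ)
    (hφ : Function.Injective φ) (hC : 0 ≤ C)
    (hval : ∀ γ ∈ Subgroup.closure S, ∃ w, val w = φ γ ∧ L w ≤ C * wordLength S γ)
    (hτ : 0 < τ) (hη0 : 0 < η) (hη1 : η < 1) (hα0 : 0 < α) (hα1 : α ≤ 1)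
    (hα : 2 * (η / 2) ^ α < 1) :
    Dominated (fun R => (growth S R : ℝ)) fun R => Real.exp (R ^ α) := by
  have hgrowth := h.growth_le hφ hC hval hτ hη0 hη1 hα0.le hα1 hα
  set K := ((1 - 2 * (η / 2) ^ α) * τ ^ α)⁻¹
  set B := Nat.card A + Nat.card P + 1
  have hK : 0 ≤ K := inv_nonneg.2 (mul_nonneg (sub_pos.2 hα).le (Real.rpow_nonneg hτ.le α))
  refine dominated_exp_rpow_of_le (D := (2 * (K * C ^ α) + 1) * Real.log B) hα0 fun R hR => ?_
  have hR0 : 0 ≤ R := zero_le_one.trans hR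
  set n := ⌊K * (C * R) ^ α⌋₊
  have hexponent : (2 * n + 1 : ℝ) ≤ (2 * (K * C ^ α) + 1) * R ^ α := by
    have hn : (n : ℝ) ≤ K * C ^ α * R ^ α := by
      rw [mul_assoc, ← Real.mul_rpow hC hR0]
      exact Nat.floor_le (mul_nonneg hK (Real.rpow_nonneg (mul_nonneg hC hR0) α))
    linarith [Real.one_le_rpow hR hα0.le]
  calc (growth S R : ℝ) ≤ (B : ℝ) ^ (2 * n + 1) := by exact_mod_cast hgrowth R
    _ = Real.exp ((2 * n + 1) * Real.log B) := by
        rw [← Real.exp_log (show (0 : ℝ) < B ^ (2 * n + 1) by positivity), Real.log_pow]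
        push_cast
        rfl
    _ ≤ Real.exp ((2 * (K * C ^ α) + 1) * Real.log B * R ^ α) := by
        rw [mul_right_comm]
        exact Real.exp_le_exp.2 (mul_le_mul_of_nonneg_right hexponent (Real.log_natCast_nonneg B))

theorem IsContracting.growth_dominated [Finite A] [Finite P] {Γ : Type*} [Group Γ]
    {S : Set Γ} {φ : Γ → X} {C : ℝ} (h : IsContracting f g val L η τ)
    (hφ : Function.Injective φ) (hC : 0 ≤ C)
    (hval : ∀ γ ∈ Subgroup.closure S, ∃ w, val w = φ γ ∧ L w ≤ C * wordLength S γ)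
    (hτ : 0 < τ) (hη0 : 0 < η) (hη1 : η < 1)
    (hα : Real.log 2 / (Real.log 2 - Real.log η) < α) :
    Dominated (fun R => (growth S R : ℝ)) fun R => Real.exp (R ^ α) := by
  have hlogη := Real.log_neg hη0 hη1
  have hlog2 := Real.log_pos one_lt_two
  have hpos : 0 < Real.log 2 / (Real.log 2 - Real.log η) := div_pos hlog2 (by linarith)
  have hlt : Real.log 2 / (Real.log 2 - Real.log η) < min α 1 :=
    lt_min hα ((div_lt_one (by linarith)).2 (by linarith))
  have hcontract := two_mul_div_two_rpow_lt_one hη0 hη1 hlt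
  exact (h.growth_dominated_of_le_one hφ hC hval hτ hη0 hη1 (hpos.trans hlt) (min_le_right α 1)
    hcontract).exp_rpow_mono (min_le_left α 1)

end Contraction

section WordGrowth

variable {η α : ℝ}

/-- The map with sections `g₀` and `g₁` that acts on last letters by translation by `p`. -/
def join (p : Fin 2) (g₀ g₁ : Word → Word) (w : Word) : Word :=
  snoc (![g₀, g₁] (w 0) (init w)) (p + w 0)

theorem join_pos_sec (w : List Letter) :
    join (pos 0 w) (val (sec 0 w)) (val (sec 1 w)) = val w := by
  funext v
  obtain ⟨u, x, rfl⟩ := exists_snoc v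
  rw [val_snoc]
  fin_cases x
  · exact congrArg (snoc _) (add_zero _)
  · exact congrArg (snoc _) (pos_one w).symm

theorem isContracting_weight (h0 : 0 ≤ η) (h1 : η ≤ 1) (hη : 2 ≤ η ^ 5 + η ^ 4 + η ^ 3) :
    IsContracting (fun x : Option Letter => ⇑(val x.toList)) join (fun w => ⇑(val w)) (weight η)
      η 2 where
  nonneg := weight_nonneg h0
  leaf_or_node w := by
    obtain ⟨v, hv, hval, hlight, -⟩ := exists_reduced h0 w
    simp only [← hval]
    obtain hlt | hle := lt_or_ge (weight η v) 2
    · left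
      match v, hv.length_le_one h0 h1 hη hlt with
      | [], _ => exact ⟨none, rfl⟩
      | [x], _ => exact ⟨some x, rfl⟩
    · exact .inr ⟨hle.trans hlight, pos 0 v, sec 0 v, sec 1 v, join_pos_sec v,
        (weight_sec_zero_add_weight_sec_one_le h0 hη hv).trans
          (mul_le_mul_of_nonneg_left hlight h0)⟩

theorem growth_gens_dominated (h0 : 0 < η) (h1 : η < 1) (hη : 2 ≤ η ^ 5 + η ^ 4 + η ^ 3)
    (hα : Real.log 2 / (Real.log 2 - Real.log η) < α) :
    Dominated (fun R => (growth gens R : ℝ)) fun R => Real.exp (R ^ α) := by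
  refine (isContracting_weight h0.le h1.le hη).growth_dominated (φ := fun g => ⇑g) (C := 8)
    DFunLike.coe_injective (by norm_num) (fun g hg => ?_) two_pos h0 h1 hα
  obtain ⟨w, rfl, hlength⟩ := exists_val_eq hg
  exact ⟨w, rfl, hlength ▸ weight_le_eight_mul_length h0.le h1.le w⟩

end WordGrowth

section Root

variable {η : ℝ}

theorem strictMonoOn_quintic :
    StrictMonoOn (fun x : ℝ => x ^ 5 + x ^ 4 + x ^ 3 - 2) (Set.Ici 0) := by
  have hpow {n : ℕ} (hn : n ≠ 0) : StrictMonoOn (fun x : ℝ => x ^ n) (Set.Ici 0) :=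
    fun x hx y _ hxy => pow_lt_pow_left₀ hxy hx hn
  exact (((hpow (by norm_num)).add (hpow (by norm_num))).add (hpow (by norm_num))).add_const (-2)

theorem exists_mem_Ioo_quintic_eq_zero :
    ∃ η ∈ Set.Ioo (0.90281 : ℝ) 0.90282, η ^ 5 + η ^ 4 + η ^ 3 - 2 = 0 := by
  have hcont : ContinuousOn (fun x : ℝ => x ^ 5 + x ^ 4 + x ^ 3 - 2) (Set.Icc 0.90281 0.90282) := by
    fun_prop
  exact intermediate_value_Ioo (by norm_num) hcont ⟨by norm_num, by norm_num⟩

theorem pos_and_quintic_eq_zero_iff (h0 : 0 < η) (hη : η ^ 5 + η ^ 4 + η ^ 3 - 2 = 0) (x : ℝ) :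
    (0 < x ∧ x ^ 5 + x ^ 4 + x ^ 3 - 2 = 0) ↔ x = η := by
  constructor
  · rintro ⟨hx0, hx⟩
    exact strictMonoOn_quintic.injOn (Set.mem_Ici.2 hx0.le) (Set.mem_Ici.2 h0.le) (hx.trans hη.symm)
  · rintro rfl
    exact ⟨h0, hη⟩

theorem log_mem_Ioo_of_mem_Ioo (hη : η ∈ Set.Ioo (0.90281 : ℝ) 0.90282) :
    Real.log η ∈ Set.Ioo (-0.102245) (-0.10223) := by
  have htaylor (x : ℝ) (hx : |x| < 1) := abs_le.1 (Real.abs_log_sub_add_sum_range_le hx 6)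
  have hlower := (htaylor 0.09719 (by norm_num [abs_of_pos])).1
  have hupper := (htaylor 0.09718 (by norm_num [abs_of_pos])).2
  rw [abs_of_pos (by norm_num)] at hlower hupper
  simp only [Finset.sum_range_succ, Finset.sum_range_zero] at hlower hupper
  have hlog₁ : Real.log (1 - 0.09719) < Real.log η :=
    Real.log_lt_log (by norm_num) (by linarith [hη.1])
  have hlog₂ : Real.log η < Real.log (1 - 0.09718) :=
    Real.log_lt_log (by linarith [hη.1]) (by linarith [hη.2])
  norm_num at hlower hupper hlog₁ hlog₂
  constructor <;> norm_num <;> linarith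

theorem abs_exponent_sub_lt (hη : η ∈ Set.Ioo (0.90281 : ℝ) 0.90282) :
    |Real.log 2 / (Real.log 2 - Real.log η) - 0.8715| < 0.00005 := by
  obtain ⟨hlower, hupper⟩ := log_mem_Ioo_of_mem_Ioo hη
  have hlog₁ := Real.log_two_gt_d9
  have hlog₂ := Real.log_two_lt_d9
  have hpos : 0 < Real.log 2 - Real.log η := by linarith
  rw [abs_lt, lt_sub_iff_add_lt, lt_div_iff₀ hpos, sub_lt_iff_lt_add, div_lt_iff₀ hpos]
  constructor <;> linarith

end Root

end FragK110

theorem mainTheorem5 :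
    -- the wreath recursions of the fragmented generators
    FragK110.HasWreathRecursion FragK110.c₀ 1 ![FragK110.c₁, FragK110.b] ∧
    FragK110.HasWreathRecursion FragK110.c₁ 1 ![FragK110.c₂, FragK110.b] ∧
    FragK110.HasWreathRecursion FragK110.c₂ 1 ![FragK110.c₀, 1] ∧
    -- `G` is a fragmentation of `⟨a, b, c⟩`, obtained by fragmenting `c` along the three pieces
    FragK110.IsFragmentation FragK110.H FragK110.c
      (Set.range fun j : Fin 3 => FragK110.piece j ∩ {w | FragK110.c w ≠ w}) ∧
    FragK110.IsFragmentationGroup {FragK110.a, FragK110.b, FragK110.c} FragK110.G ∧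
    -- `0^ω` is the purely non-Hausdorff singularity of `G`
    (∀ ζ : FragK110.Word,
      FragK110.IsPurelyNonHausdorff FragK110.gens ζ ↔ ζ = FragK110.zeroWord) ∧
    -- its group of germs is `⟨c₀, c₁, c₂⟩`, isomorphic to `(ℤ/2)²`
    Nonempty (FragK110.H ≃* Multiplicative (ZMod 2 × ZMod 2)) ∧
    Nonempty (FragK110.GermGroup FragK110.G FragK110.zeroWord ≃*
      Multiplicative (ZMod 2 × ZMod 2)) ∧
    (∀ h ∈ FragK110.H, h FragK110.zeroWord = FragK110.zeroWord) ∧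
    (∀ g ∈ FragK110.G, g FragK110.zeroWord = FragK110.zeroWord →
      ∃! h : FragK110.Word ≃ₜ FragK110.Word,
        h ∈ FragK110.H ∧ ∀ᶠ x in nhds FragK110.zeroWord, g x = h x) ∧
    -- the growth estimate
    ∃ η : ℝ, (∀ x : ℝ, (0 < x ∧ x ^ 5 + x ^ 4 + x ^ 3 - 2 = 0) ↔ x = η) ∧
      |η - 0.9028| < 0.00005 ∧
      |Real.log 2 / (Real.log 2 - Real.log η) - 0.8715| < 0.00005 ∧
      ∀ α : ℝ, Real.log 2 / (Real.log 2 - Real.log η) < α →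
        FragK110.Dominated (fun R => (FragK110.growth FragK110.gens R : ℝ))
          (fun R => Real.exp (R ^ α)) := by
  obtain ⟨e⟩ := FragK110.nonempty_H_mulEquiv
  obtain ⟨f⟩ := FragK110.nonempty_H_mulEquiv_germGroup
  obtain ⟨η, hη, hroot⟩ := FragK110.exists_mem_Ioo_quintic_eq_zero
  have hη0 : 0 < η := by linarith [hη.1]
  have hη1 : η < 1 := by linarith [hη.2]
  refine ⟨FragK110.wreath_c₀, FragK110.wreath_c₁, FragK110.wreath_c₂, FragK110.isFragmentation_H,
    FragK110.isFragmentationGroup_G, FragK110.isPurelyNonHausdorff_iff, ⟨e⟩, ⟨f.symm.trans e⟩,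
    fun _ => FragK110.H_apply_zeroWord, fun _ => FragK110.existsUnique_H_germ, η,
    FragK110.pos_and_quintic_eq_zero_iff hη0 hroot, ?_, FragK110.abs_exponent_sub_lt hη,
    fun α => FragK110.growth_gens_dominated hη0 hη1 (sub_eq_zero.1 hroot).ge⟩
  rw [abs_lt]
  constructor <;> linarith [hη.1, hη.2]
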